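/- **Setting.** A *commutative integral residuated lattice* is an algebra $(A,\cdot,\to,\wedge,\vee,1)$ such that $(A,\cdot,1)$ is a commutative monoid, $(A,\wedge,\vee)$ is a lattice with top element $1$, and $x\cdot y\le z$ iff $y\le x\to z$. The variety $\mathsf{WH}$ of *Wajsberg hoops* consists of those satisfying $(x\to y)\to y=(y\to x)\to x$ and $x\wedge y=x\cdot(x\to y)$. The variety $\mathsf{MV}$ of *MV-algebras* consists of the commutative integral residuated lattices with an additional constant $0$, the bottom element, satisfying $(x\to y)\to y=x\vee y$. A *Wajsberg term* is a term in the signature $\{\cdot,\to,\wedge,\vee,1\}$; it is also an MV-term (a positive formula of Łukasiewicz logic). For a Wajsberg term $t$ in $n$ variables let $f_t:[0,1]^n\to[0,1]$ be its term function in the standard algebra on $[0,1]$, where $x\cdot y=\max\{0,x+y-1\}$, $x\to y=\min\{1,y-x+1\}$, and $\wedge,\vee$ are $\min,\max$; let $O_t=\{\mathbf x\in[0,1]^n: f_t(\mathbf x)=1\}$ be its one-set. Let Ł (infinite-valued Łukasiewicz logic) be the extension of the Hilbert calculus of the Full Lambek calculus with exchange $\mathbf{FL}_e$ (rules: modus ponens,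 and from $\varphi$ infer $\varphi\wedge1$) by the axiom schemes $\varphi\to(\psi\to\varphi)$, $0\to\varphi$ and $((\varphi\to\psi)\to\psi)\to(\varphi\vee\psi)$, and let Ł$^+$ (its positive fragment) be the calculus on $0$-free formulas that extends the $0$-free calculus of $\mathbf{FL}_e$ by the axiom schemes $\varphi\to(\psi\to\varphi)$, $((\varphi\to\psi)\to\psi)\to((\psi\to\varphi)\to\varphi)$ and $(\varphi\wedge\psi)\to\varphi\cdot(\varphi\to\psi)$. **Proposition.** Let $n\in\mathbb N$ and let $t,u$ be Wajsberg terms in $n$ variables. The following are equivalent: 1. the quasiequation $t\approx1\Rightarrow u\approx1$ holds in every Wajsberg hoop; 2. $O_t\subseteq O_u$; 3. the quasiequation $t\approx1\Rightarrow u\approx1$ holds in every MV-algebra; 4. $u$ is deducible from $t$ in Ł$^+$; 5. $u$ is deducible from $t$ in Ł. In particular, deducibility in the positive fragment of Łukasiewicz logic coincides with deducibility among positive formulas in Łukasiewicz logic. -/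

import Mathlib

universe w₁ w₂

/-- A commutative integral residuated lattice `(A, ·, →, ∧, ∨, 1)`; the residuum `→` is written
`⇨`, and the meet and join are written `⊓` and `⊔`. -/
class CommIntegralResiduatedLattice (A : Type*) extends Lattice A, CommMonoid A, HImp A where
  mul_le_iff_le_himp : ∀ x y z : A, x * y ≤ z ↔ y ≤ x ⇨ z
  le_one : ∀ x : A, x ≤ 1

/-- A Wajsberg hoop in the signature of residuated lattices: a commutative integral residuated
lattice satisfying Tanaka's equation and divisibility. -/
class WajsbergHoop (A : Type*) extends CommIntegralResiduatedLattice A where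
  tanaka : ∀ x y : A, (x ⇨ y) ⇨ y = (y ⇨ x) ⇨ x
  divisibility : ∀ x y : A, x ⊓ y = x * (x ⇨ y)

/-- An MV-algebra in the signature `(·, →, ∧, ∨, 0, 1)`: a commutative integral residuated lattice
with a constant `0` that is the bottom element, satisfying `(x → y) → y = x ∨ y`. -/
class MVAlgebra (A : Type*) extends CommIntegralResiduatedLattice A, Zero A where
  zero_le : ∀ x : A, 0 ≤ x
  himp_himp_eq_sup : ∀ x y : A, (x ⇨ y) ⇨ y = x ⊔ y

/-- Wajsberg terms (positive formulas) in the variables `x_0, …, x_{n-1}`. -/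
inductive WTerm (n : ℕ) : Type where
  | var : Fin n → WTerm n
  | one : WTerm n
  | mul : WTerm n → WTerm n → WTerm n
  | imp : WTerm n → WTerm n → WTerm n
  | inf : WTerm n → WTerm n → WTerm n
  | sup : WTerm n → WTerm n → WTerm n

/-- MV-terms (formulas of Łukasiewicz logic) in the variables `x_0, …, x_{n-1}`. -/
inductive MVTerm (n : ℕ) : Type where
  | var : Fin n → MVTerm n
  | zero : MVTerm n
  | one : MVTerm n
  | mul : MVTerm n → MVTerm n → MVTerm n
  | imp : MVTerm n → MVTerm n → MVTerm n
  | inf : MVTerm n → MVTerm n → MVTerm n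
  | sup : MVTerm n → MVTerm n → MVTerm n

/-! The connectives as operations on terms. -/

instance {n : ℕ} : One (WTerm n) := ⟨WTerm.one⟩
instance {n : ℕ} : Mul (WTerm n) := ⟨WTerm.mul⟩
instance {n : ℕ} : HImp (WTerm n) := ⟨WTerm.imp⟩
instance {n : ℕ} : Min (WTerm n) := ⟨WTerm.inf⟩
instance {n : ℕ} : Max (WTerm n) := ⟨WTerm.sup⟩

instance {n : ℕ} : Zero (MVTerm n) := ⟨MVTerm.zero⟩
instance {n : ℕ} : One (MVTerm n) := ⟨MVTerm.one⟩
instance {n : ℕ} : Mul (MVTerm n) := ⟨MVTerm.mul⟩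
instance {n : ℕ} : HImp (MVTerm n) := ⟨MVTerm.imp⟩
instance {n : ℕ} : Min (MVTerm n) := ⟨MVTerm.inf⟩
instance {n : ℕ} : Max (MVTerm n) := ⟨MVTerm.sup⟩

/-- A Wajsberg term read as a (positive) MV-term. -/
def WTerm.toMV {n : ℕ} : WTerm n → MVTerm n
  | .var i => .var i
  | .one => .one
  | .mul a b => .mul a.toMV b.toMV
  | .imp a b => .imp a.toMV b.toMV
  | .inf a b => .inf a.toMV b.toMV
  | .sup a b => .sup a.toMV b.toMV

/-- The value of a Wajsberg term under an assignment of its variables. -/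
def WTerm.eval {n : ℕ} {A : Type*} [CommIntegralResiduatedLattice A] (v : Fin n → A) :
    WTerm n → A
  | .var i => v i
  | .one => 1
  | .mul a b => a.eval v * b.eval v
  | .imp a b => a.eval v ⇨ b.eval v
  | .inf a b => a.eval v ⊓ b.eval v
  | .sup a b => a.eval v ⊔ b.eval v

/-- The value of an MV-term under an assignment of its variables. -/
def MVTerm.eval {n : ℕ} {A : Type*} [MVAlgebra A] (v : Fin n → A) : MVTerm n → A
  | .var i => v i
  | .zero => 0
  | .one => 1
  | .mul a b => a.eval v * b.eval v
  | .imp a b => a.eval v ⇨ b.eval v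
  | .inf a b => a.eval v ⊓ b.eval v
  | .sup a b => a.eval v ⊔ b.eval v

/-- The quasiequation `t ≈ 1 ⇒ s ≈ 1` holds in the variety of Wajsberg hoops. -/
def WHModels.{w} {n : ℕ} (t s : WTerm n) : Prop :=
  ∀ (A : Type w) [WajsbergHoop A] (v : Fin n → A), t.eval v = 1 → s.eval v = 1

/-- The quasiequation `t ≈ 1 ⇒ s ≈ 1` holds in the variety of MV-algebras. -/
def MVModels.{w} {n : ℕ} (t s : MVTerm n) : Prop :=
  ∀ (A : Type w) [MVAlgebra A] (v : Fin n → A), t.eval v = 1 → s.eval v = 1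

/-- The carrier of the standard algebra, the real interval `[0,1]`, as a type of its own: the
monoid operation on it is the Łukasiewicz t-norm, not the product of real numbers. -/
def StdUnit : Type := Set.Icc (0 : ℝ) 1

namespace StdUnit

noncomputable section

instance : Lattice StdUnit := inferInstanceAs (Lattice (Set.Icc (0 : ℝ) 1))

/-- The Łukasiewicz t-norm `max {0, x + y - 1}`. -/
def tnorm (x y : StdUnit) : StdUnit :=
  ⟨max 0 (x.1 + y.1 - 1), le_max_left _ _,
    max_le zero_le_one (by linarith [x.2.2, y.2.2])⟩

/-- The Łukasiewicz residuum `min {1, y - x + 1}`. -/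
def residuum (x y : StdUnit) : StdUnit :=
  ⟨min 1 (y.1 - x.1 + 1), le_min zero_le_one (by linarith [x.2.2, y.2.1]), min_le_left _ _⟩

/-- The real number `0` as an element of `[0,1]`. -/
def bottom : StdUnit := ⟨0, le_refl _, zero_le_one⟩

/-- The real number `1` as an element of `[0,1]`. -/
def top : StdUnit := ⟨1, zero_le_one, le_refl _⟩

theorem tnorm_assoc (x y z : StdUnit) : tnorm (tnorm x y) z = tnorm x (tnorm y z) := by
  obtain ⟨x, hx0, hx1⟩ := x
  obtain ⟨y, hy0, hy1⟩ := y
  obtain ⟨z, hz0, hz1⟩ := z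
  apply Subtype.ext
  simp only [tnorm]
  grind

theorem tnorm_comm (x y : StdUnit) : tnorm x y = tnorm y x := by
  apply Subtype.ext
  simp only [tnorm]
  grind

theorem top_tnorm (x : StdUnit) : tnorm top x = x := by
  obtain ⟨x, hx0, hx1⟩ := x
  apply Subtype.ext
  simp only [tnorm, top]
  grind

theorem tnorm_le_iff (x y z : StdUnit) : tnorm x y ≤ z ↔ y ≤ residuum x z := by
  obtain ⟨x, hx0, hx1⟩ := x
  obtain ⟨y, hy0, hy1⟩ := y
  obtain ⟨z, hz0, hz1⟩ := z
  change max 0 (x + y - 1) ≤ z ↔ y ≤ min 1 (z - x + 1)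
  grind

theorem residuum_residuum (x y : StdUnit) : residuum (residuum x y) y = x ⊔ y := by
  obtain ⟨x, hx0, hx1⟩ := x
  obtain ⟨y, hy0, hy1⟩ := y
  apply Subtype.ext
  change min 1 (y - min 1 (y - x + 1) + 1) = max x y
  grind

theorem inf_eq_tnorm (x y : StdUnit) : x ⊓ y = tnorm x (residuum x y) := by
  obtain ⟨x, hx0, hx1⟩ := x
  obtain ⟨y, hy0, hy1⟩ := y
  apply Subtype.ext
  change min x y = max 0 (x + min 1 (y - x + 1) - 1)
  grind

instance : CommMonoid StdUnit where
  mul := tnorm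
  one := top
  mul_assoc := tnorm_assoc
  mul_comm := tnorm_comm
  one_mul := top_tnorm
  mul_one x := (tnorm_comm x top).trans (top_tnorm x)

instance : CommIntegralResiduatedLattice StdUnit where
  himp := residuum
  mul_le_iff_le_himp := tnorm_le_iff
  le_one x := x.2.2

/-- The standard MV-algebra. -/
instance : MVAlgebra StdUnit where
  zero := bottom
  zero_le x := x.2.1
  himp_himp_eq_sup := residuum_residuum

/-- The standard Wajsberg hoop, the `0`-free reduct of the standard MV-algebra. -/
instance : WajsbergHoop StdUnit where
  tanaka x y := (residuum_residuum x y).trans ((sup_comm x y).trans (residuum_residuum y x).symm)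
  divisibility := inf_eq_tnorm

end

end StdUnit

/-- The Wajsberg function `[0,1]^n → [0,1]` of a Wajsberg term. -/
noncomputable def WTerm.wajsbergFunction {n : ℕ} (t : WTerm n) : (Fin n → StdUnit) → StdUnit :=
  fun x => t.eval x

/-- The one-set of (the Wajsberg function of) a Wajsberg term, a subset of `[0,1]^n`. -/
def WTerm.oneSet {n : ℕ} (t : WTerm n) : Set (Fin n → StdUnit) := {x | t.wajsbergFunction x = 1}

/-- `FLeDeduces Ax Γ φ`: the formula `φ` is derivable from the premises `Γ` in the axiomatic
extension by `Ax` of the Hilbert calculus for the Full Lambek calculus with exchange. No axiom or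
rule of that calculus mentions the constant `0`, so it is set up for any set of formulas `F` with
the connectives `·, →, ∧, ∨, 1`. -/
inductive FLeDeduces {F : Type*} [One F] [Mul F] [HImp F] [Min F] [Max F] (Ax Γ : Set F) :
    F → Prop where
  | ax {φ : F} : φ ∈ Ax → FLeDeduces Ax Γ φ
  | premise {φ : F} : φ ∈ Γ → FLeDeduces Ax Γ φ
  | identity (φ : F) : FLeDeduces Ax Γ (φ ⇨ φ)
  | prefixing (φ ψ χ : F) : FLeDeduces Ax Γ ((φ ⇨ ψ) ⇨ ((χ ⇨ φ) ⇨ (χ ⇨ ψ)))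
  | exchange (φ ψ χ : F) : FLeDeduces Ax Γ ((φ ⇨ (ψ ⇨ χ)) ⇨ (ψ ⇨ (φ ⇨ χ)))
  | mul_inf (φ ψ : F) : FLeDeduces Ax Γ (((φ ⊓ 1) * (ψ ⊓ 1)) ⇨ (φ ⊓ ψ))
  | inf_left (φ ψ : F) : FLeDeduces Ax Γ ((φ ⊓ ψ) ⇨ φ)
  | inf_right (φ ψ : F) : FLeDeduces Ax Γ ((φ ⊓ ψ) ⇨ ψ)
  | imp_inf (φ ψ χ : F) : FLeDeduces Ax Γ (((φ ⇨ ψ) ⊓ (φ ⇨ χ)) ⇨ (φ ⇨ (ψ ⊓ χ)))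
  | sup_left (φ ψ : F) : FLeDeduces Ax Γ (φ ⇨ (φ ⊔ ψ))
  | sup_right (φ ψ : F) : FLeDeduces Ax Γ (ψ ⇨ (φ ⊔ ψ))
  | sup_imp (φ ψ χ : F) : FLeDeduces Ax Γ (((φ ⇨ χ) ⊓ (ψ ⇨ χ)) ⇨ ((φ ⊔ ψ) ⇨ χ))
  | imp_mul (φ ψ : F) : FLeDeduces Ax Γ (φ ⇨ (ψ ⇨ (ψ * φ)))
  | mul_imp (φ ψ χ : F) : FLeDeduces Ax Γ ((ψ ⇨ (φ ⇨ χ)) ⇨ ((φ * ψ) ⇨ χ))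
  | one : FLeDeduces Ax Γ 1
  | one_imp (φ : F) : FLeDeduces Ax Γ (1 ⇨ (φ ⇨ φ))
  | modusPonens {φ ψ : F} : FLeDeduces Ax Γ φ → FLeDeduces Ax Γ (φ ⇨ ψ) → FLeDeduces Ax Γ ψ
  | adjUnit {φ : F} : FLeDeduces Ax Γ φ → FLeDeduces Ax Γ (φ ⊓ 1)

/-- The axioms of Łukasiewicz logic over the Full Lambek calculus with exchange: weakening,
ex falso, and `((φ → ψ) → ψ) → (φ ∨ ψ)`. -/
inductive LukAxiom {n : ℕ} : MVTerm n → Prop where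
  | weakening (φ ψ : MVTerm n) : LukAxiom (φ ⇨ (ψ ⇨ φ))
  | exFalso (φ : MVTerm n) : LukAxiom (0 ⇨ φ)
  | lukasiewicz (φ ψ : MVTerm n) : LukAxiom (((φ ⇨ ψ) ⇨ ψ) ⇨ (φ ⊔ ψ))

/-- The axioms of positive Łukasiewicz logic over the (`0`-free) Full Lambek calculus with
exchange: weakening, Tanaka's axiom and divisibility. -/
inductive PosLukAxiom {n : ℕ} : WTerm n → Prop where
  | weakening (φ ψ : WTerm n) : PosLukAxiom (φ ⇨ (ψ ⇨ φ))
  | tanaka (φ ψ : WTerm n) : PosLukAxiom (((φ ⇨ ψ) ⇨ ψ) ⇨ ((ψ ⇨ φ) ⇨ φ))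
  | divisibility (φ ψ : WTerm n) : PosLukAxiom ((φ ⊓ ψ) ⇨ (φ * (φ ⇨ ψ)))

/-- Deducibility in infinite-valued Łukasiewicz logic. -/
def LukDeduces {n : ℕ} (Γ : Set (MVTerm n)) (φ : MVTerm n) : Prop :=
  FLeDeduces {ψ | LukAxiom ψ} Γ φ

/-- Deducibility in positive Łukasiewicz logic: formulas and derivations are `0`-free. -/
def PosLukDeduces {n : ℕ} (Γ : Set (WTerm n)) (φ : WTerm n) : Prop :=
  FLeDeduces {ψ | PosLukAxiom ψ} Γ φ

/-!
All five conditions follow from one completeness fact: if `u` is not deducible from `t` in the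
positive calculus, then some point of `[0,1]^n` lies in the one-set of `t` but not in that of `u`
(`posLukDeduces_of_oneSet_subset`). The remaining implications are soundness, the standard algebra
being an instance in every universe, the fact that the `0`-free reduct of an MV-algebra is a
Wajsberg hoop, and the fact that the Lindenbaum algebra of Łukasiewicz logic is an MV-algebra; the
last two make derivations in the positive calculus valid in the full one.

For the completeness fact, enlarge `{t}` to a set of premises that is maximal among those not
yielding `u`. By the local deduction theorem and prelinearity its Lindenbaum algebra is a totally
ordered Wajsberg hoop (`exists_total_posLindenbaum`). Evaluating `t` and `u` involves finitely many
elements, all above some `m`, and the interval `[m, 1]` with truncated product is an MV-chain on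
which the two terms take the same values (`WTerm.eval_interval`).

An MV-chain is an interval of a totally ordered abelian group, Chang's group of pairs of an integer
and a nonzero element of the chain (`ChangGroup`); in this special case the group laws reduce to
three short identities of Wajsberg hoops. In the group, the values of terms are piecewise linear
with integer coefficients, so that the failure of the quasiequation becomes a solution of a finite
system of homogeneous linear inequalities (`WTerm.exists_form`). Fourier–Motzkin elimination, whose
steps are valid in every ordered abelian group, produces a solution over the reals
(`FourierMotzkin.exists_real_solution`), which is rescaled to a point of `[0,1]^n`.
-/

/-! ### Fourier–Motzkin elimination -/

namespace FourierMotzkin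

/-- The value at `x` of the homogeneous linear form with integer coefficients `c`. -/
def form {N : ℕ} {H : Type*} [AddCommGroup H] (c : Fin N → ℤ) (x : Fin N → H) : H :=
  ∑ i, c i • x i

/-- The condition that `g` is positive (if `b` is true) or nonnegative (if `b` is false). -/
def Holds {H : Type*} [AddCommGroup H] [LinearOrder H] (b : Bool) (g : H) : Prop :=
  0 ≤ g ∧ (b = true → 0 < g)

section form

variable {N : ℕ} {H : Type*} [AddCommGroup H]

theorem form_add (c d : Fin N → ℤ) (x : Fin N → H) : form (c + d) x = form c x + form d x := by
  simp [form, add_smul, Finset.sum_add_distrib]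

theorem form_sub (c d : Fin N → ℤ) (x : Fin N → H) : form (c - d) x = form c x - form d x := by
  simp [form, sub_smul, Finset.sum_sub_distrib]

theorem form_neg (c : Fin N → ℤ) (x : Fin N → H) : form (-c) x = -form c x := by
  simp [form]

theorem form_smul (k : ℤ) (c : Fin N → ℤ) (x : Fin N → H) : form (k • c) x = k • form c x := by
  simp [form, mul_smul, Finset.smul_sum]

theorem form_zero (x : Fin N → H) : form 0 x = 0 := by
  simp [form]

theorem form_single (i : Fin N) (x : Fin N → H) : form (Pi.single i 1) x = x i := by
  simp [form, Pi.single_apply]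

theorem form_succ (c : Fin (N + 1) → ℤ) (x : Fin (N + 1) → H) :
    form c x = c 0 • x 0 + form (Fin.tail c) (Fin.tail x) := by
  simp [form, Fin.sum_univ_succ, Fin.tail]

end form

/-- The combination of a lower bound `p` and an upper bound `q` for the first variable in which
that variable cancels. -/
def combine {N : ℕ} (p q : (Fin (N + 1) → ℤ) × Bool) : (Fin N → ℤ) × Bool :=
  ((-q.1 0) • Fin.tail p.1 + p.1 0 • Fin.tail q.1, p.2 || q.2)

theorem form_combine {N : ℕ} {H : Type*} [AddCommGroup H] (p q : (Fin (N + 1) → ℤ) × Bool)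
    (x : Fin (N + 1) → H) :
    form (combine p q).1 (Fin.tail x) = (-q.1 0) • form p.1 x + p.1 0 • form q.1 x := by
  rw [form_succ p.1, form_succ q.1, combine, form_add, form_smul, form_smul]
  module

/-- Finitely many lower bounds and finitely many upper bounds, some of them strict, leave room for
a real number as soon as they do so pairwise. -/
theorem exists_real_between {α β : Type*} {P : Set α} {Q : Set β} (hP : P.Finite) (hQ : Q.Finite)
    (l : α → ℝ) (u : β → ℝ) (s : α → Bool) (r : β → Bool)
    (h : ∀ p ∈ P, ∀ q ∈ Q, l p ≤ u q ∧ ((s p || r q) = true → l p < u q)) :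
    ∃ z : ℝ, (∀ p ∈ P, l p ≤ z ∧ (s p = true → l p < z)) ∧
      (∀ q ∈ Q, z ≤ u q ∧ (r q = true → z < u q)) := by
  -- If a lower bound meets an upper bound, both are nonstrict and their common value is the only
  -- choice; otherwise all pairs are strictly separated.
  by_cases hpq : ∃ p ∈ P, ∃ q ∈ Q, l p = u q
  · obtain ⟨p, hp, q, hq, e⟩ := hpq
    have hs := (h p hp q hq).2
    rw [e] at hs
    have hs' : ¬ ((s p || r q) = true) := fun H => lt_irrefl _ (hs H)
    simp only [Bool.or_eq_true, not_or] at hs'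
    refine ⟨l p, fun p' hp' => ?_, fun q' hq' => ?_⟩
    · rw [e]
      exact ⟨(h p' hp' q hq).1, fun H => (h p' hp' q hq).2 (by simp [H])⟩
    · exact ⟨(h p hp q' hq').1, fun H => (h p hp q' hq').2 (by simp [H])⟩
  · push Not at hpq
    obtain ⟨z, hz1, hz2⟩ := Order.exists_between_finsets (hP.image l).toFinset (hQ.image u).toFinset
      (by
        intro x hx y hy
        simp only [Set.Finite.mem_toFinset, Set.mem_image] at hx hy
        obtain ⟨p, hp, rfl⟩ := hx
        obtain ⟨q, hq, rfl⟩ := hy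
        exact lt_of_le_of_ne (h p hp q hq).1 (hpq p hp q hq))
    refine ⟨z, fun p hp => ?_, fun q hq => ?_⟩
    · have := hz1 (l p) (by simpa using ⟨p, hp, rfl⟩)
      exact ⟨this.le, fun _ => this⟩
    · have := hz2 (u q) (by simpa using ⟨q, hq, rfl⟩)
      exact ⟨this.le, fun _ => this⟩

/-- Elimination of one variable: the derived system is a consequence of the original one in every
ordered group, and over the reals each of its solutions extends to a solution of the original. -/
theorem exists_real_solution {G : Type*} [AddCommGroup G] [LinearOrder G] [IsOrderedAddMonoid G] :
    ∀ {N : ℕ} {S : Set ((Fin N → ℤ) × Bool)}, S.Finite → ∀ x : Fin N → G,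
      (∀ c ∈ S, Holds c.2 (form c.1 x)) → ∃ y : Fin N → ℝ, ∀ c ∈ S, Holds c.2 (form c.1 y)
  | 0, S, _, x, hx => ⟨0, fun c hc => by
      have := hx c hc
      simpa [form, Holds] using this⟩
  | N + 1, S, hS, x, hx => by
    set P := {c ∈ S | 0 < c.1 0}
    set Q := {c ∈ S | c.1 0 < 0}
    set Z := {c ∈ S | c.1 0 = 0}
    have hP : P.Finite := hS.subset (Set.sep_subset _ _)
    have hQ : Q.Finite := hS.subset (Set.sep_subset _ _)
    have hZ : Z.Finite := hS.subset (Set.sep_subset _ _)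
    obtain ⟨y, hy⟩ := exists_real_solution
      (S := (fun c : (Fin (N + 1) → ℤ) × Bool => (Fin.tail c.1, c.2)) '' Z ∪ Set.image2 combine P Q)
      ((hZ.image _).union (hP.image2 _ hQ)) (Fin.tail x) (by
        rintro c (⟨d, hd, rfl⟩ | ⟨p, hp, q, hq, rfl⟩)
        · have := hx d hd.1
          rw [form_succ, hd.2, zero_smul, zero_add] at this
          exact this
        · rw [form_combine]
          have h1 := hx p hp.1
          have h2 := hx q hq.1
          have hp0 : 0 < p.1 0 := hp.2
          have hq0 : 0 < -q.1 0 := by have : q.1 0 < 0 := hq.2; omega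
          refine ⟨add_nonneg (zsmul_nonneg h1.1 hq0.le) (zsmul_nonneg h2.1 hp0.le), fun hs => ?_⟩
          simp only [combine, Bool.or_eq_true] at hs
          rcases hs with hs | hs
          · exact add_pos_of_pos_of_nonneg (zsmul_pos (h1.2 hs) hq0) (zsmul_nonneg h2.1 hp0.le)
          · exact add_pos_of_nonneg_of_pos (zsmul_nonneg h1.1 hq0.le) (zsmul_pos (h2.2 hs) hp0))
    obtain ⟨z, hz1, hz2⟩ := exists_real_between hP hQ
      (fun p => -form (Fin.tail p.1) y / (p.1 0 : ℝ)) (fun q => form (Fin.tail q.1) y / (-(q.1 0 : ℝ)))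
      (fun p => p.2) (fun q => q.2) (by
        intro p hp q hq
        have h := hy _ (Or.inr ⟨p, hp, q, hq, rfl⟩)
        have hp0 : (0 : ℝ) < p.1 0 := by exact_mod_cast hp.2
        have hq0 : (0 : ℝ) < -(q.1 0 : ℝ) := by
          have : q.1 0 < 0 := hq.2
          have : (q.1 0 : ℝ) < 0 := by exact_mod_cast this
          linarith
        simp only [combine, form_add, form_smul] at h
        simp only [zsmul_eq_mul] at h
        push_cast at h
        refine ⟨?_, fun hs => ?_⟩
        · rw [div_le_div_iff₀ hp0 hq0]
          linarith [h.1]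
        · rw [div_lt_div_iff₀ hp0 hq0]
          linarith [h.2 hs])
    refine ⟨Fin.cons z y, fun c hc => ?_⟩
    rw [form_succ, Fin.cons_zero, Fin.tail_cons, zsmul_eq_mul]
    rcases lt_trichotomy (c.1 0) 0 with h0 | h0 | h0
    · have h := hz2 c ⟨hc, h0⟩
      have hq0 : (0 : ℝ) < -(c.1 0 : ℝ) := by
        have : (c.1 0 : ℝ) < 0 := by exact_mod_cast h0
        linarith
      rw [le_div_iff₀ hq0, lt_div_iff₀ hq0] at h
      exact ⟨by linarith [h.1], fun hs => by linarith [h.2 hs]⟩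
    · have h := hy _ (Or.inl ⟨c, ⟨hc, h0⟩, rfl⟩)
      simpa [h0] using h
    · have h := hz1 c ⟨hc, h0⟩
      have hp0 : (0 : ℝ) < c.1 0 := by exact_mod_cast h0
      rw [div_le_iff₀ hp0, div_lt_iff₀ hp0] at h
      exact ⟨by linarith [h.1], fun hs => by linarith [h.2 hs]⟩

end FourierMotzkin

/-! ### Residuated lattices and Wajsberg hoops -/

namespace CommIntegralResiduatedLattice

variable {A : Type*} [CommIntegralResiduatedLattice A] {x y z w : A}

theorem mul_himp_le (x y : A) : x * (x ⇨ y) ≤ y := (mul_le_iff_le_himp _ _ _).2 le_rfl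

theorem le_himp_iff_mul_le : x ≤ y ⇨ z ↔ x * y ≤ z := by
  rw [mul_comm, mul_le_iff_le_himp]

theorem mul_le_mul_of_le (h₁ : x ≤ y) (h₂ : z ≤ w) : x * z ≤ y * w := by
  have h : z ≤ y ⇨ y * w := h₂.trans ((mul_le_iff_le_himp _ _ _).1 le_rfl)
  rw [mul_comm, mul_le_iff_le_himp]
  refine h₁.trans ?_
  rw [le_himp_iff_mul_le, mul_le_iff_le_himp]
  exact h

theorem mul_le_left' (x y : A) : x * y ≤ x := by
  simpa using mul_le_mul_of_le le_rfl (le_one y) (x := x)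

theorem mul_le_right' (x y : A) : x * y ≤ y := by
  simpa using mul_le_mul_of_le (le_one x) le_rfl (z := y)

theorem le_himp_self (x y : A) : y ≤ x ⇨ y := le_himp_iff_mul_le.2 (mul_le_left' _ _)

theorem himp_eq_one_iff : x ⇨ y = 1 ↔ x ≤ y := by
  rw [← mul_one x, mul_le_iff_le_himp, mul_one]
  exact ⟨ge_of_eq, le_antisymm (le_one _)⟩

theorem one_himp (x : A) : 1 ⇨ x = x :=
  le_antisymm (by simpa using mul_himp_le 1 x) (le_himp_self _ _)

theorem himp_himp_eq_mul_himp (x y z : A) : x ⇨ (y ⇨ z) = (x * y) ⇨ z :=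
  le_antisymm
    (by rw [le_himp_iff_mul_le, ← mul_assoc, ← le_himp_iff_mul_le, ← le_himp_iff_mul_le])
    (by rw [le_himp_iff_mul_le, le_himp_iff_mul_le, mul_assoc, ← le_himp_iff_mul_le])

theorem himp_exchange (x y z : A) : x ⇨ (y ⇨ z) = y ⇨ (x ⇨ z) := by
  rw [himp_himp_eq_mul_himp, himp_himp_eq_mul_himp, mul_comm]

theorem himp_le_himp_of_le (h₁ : x ≤ y) (h₂ : z ≤ w) : y ⇨ z ≤ x ⇨ w := by
  rw [le_himp_iff_mul_le]
  exact (mul_le_mul_of_le le_rfl h₁).trans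
    (((mul_comm _ _).le.trans (mul_himp_le _ _)).trans h₂)

theorem le_himp_himp_self (x y : A) : x ≤ (x ⇨ y) ⇨ y :=
  le_himp_iff_mul_le.2 (mul_himp_le _ _)

theorem himp_inf_eq (x y z : A) : x ⇨ (y ⊓ z) = (x ⇨ y) ⊓ (x ⇨ z) :=
  le_antisymm (le_inf (himp_le_himp_of_le le_rfl inf_le_left) (himp_le_himp_of_le le_rfl inf_le_right))
    (le_himp_iff_mul_le.2 (le_inf
      (le_himp_iff_mul_le.1 inf_le_left) (le_himp_iff_mul_le.1 inf_le_right)))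

theorem mul_sup_le (x y z : A) : x * (y ⊔ z) ≤ x * y ⊔ x * z :=
  (mul_le_iff_le_himp _ _ _).2 (sup_le ((mul_le_iff_le_himp _ _ _).1 le_sup_left)
    ((mul_le_iff_le_himp _ _ _).1 le_sup_right))

theorem sup_mul_eq_one (hy : x ⊔ y = 1) (hz : x ⊔ z = 1) : x ⊔ y * z = 1 := by
  refine le_antisymm (le_one _) ?_
  calc (1 : A) = (x ⊔ y) * (x ⊔ z) := by rw [hy, hz, mul_one]
    _ ≤ (x ⊔ y) * x ⊔ (x ⊔ y) * z := mul_sup_le _ _ _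
    _ ≤ x ⊔ y * z := by
      refine sup_le ((mul_le_right' _ _).trans le_sup_left) ?_
      rw [mul_comm]
      refine (mul_sup_le _ _ _).trans (sup_le ((mul_le_right' _ _).trans le_sup_left) ?_)
      rw [mul_comm]
      exact le_sup_right

theorem sup_pow_eq_one (h : x ⊔ y = 1) (l : ℕ) : x ⊔ y ^ l = 1 := by
  induction l with
  | zero => simpa using le_one x
  | succ l ih => rw [pow_succ]; exact sup_mul_eq_one ih h

theorem pow_sup_pow_eq_one (h : x ⊔ y = 1) (k l : ℕ) : x ^ k ⊔ y ^ l = 1 := by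
  rw [sup_comm]
  exact sup_pow_eq_one (by rw [sup_comm]; exact sup_pow_eq_one h l) k

end CommIntegralResiduatedLattice

open CommIntegralResiduatedLattice

namespace WajsbergHoop

variable {A : Type*} [WajsbergHoop A]

theorem himp_himp_eq_sup (x y : A) : (x ⇨ y) ⇨ y = x ⊔ y := by
  refine le_antisymm ?_ (sup_le (le_himp_himp_self _ _) (le_himp_self _ _))
  have h : (x ⇨ y) ⇨ y ≤ ((x ⊔ y) ⇨ y) ⇨ y :=
    himp_le_himp_of_le (himp_le_himp_of_le le_sup_left le_rfl) le_rfl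
  rwa [tanaka (x ⊔ y) y, himp_eq_one_iff.2 le_sup_right, one_himp] at h

theorem himp_himp_cancel {x y : A} (h : y ≤ x) : (x ⇨ y) ⇨ y = x := by
  rw [himp_himp_eq_sup, sup_eq_left.2 h]

theorem mul_himp_cancel {x y : A} (h : y ≤ x) : x * (x ⇨ y) = y := by
  rw [← divisibility, inf_eq_right.2 h]

theorem himp_sup_himp_eq_one (a b : A) : (a ⇨ b) ⊔ (b ⇨ a) = 1 := by
  have ha : a ⇨ b = a ⇨ (a ⊓ b) := by
    rw [himp_inf_eq, himp_eq_one_iff.2 le_rfl, inf_eq_right.2 (le_one _)]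
  have hb : b ⇨ a = b ⇨ (a ⊓ b) := by
    rw [himp_inf_eq, himp_eq_one_iff.2 (le_refl b), inf_eq_left.2 (le_one _)]
  -- Against the common lower bound `a ⊓ b`, the implication `(a ⇨ b) ⇨ (b ⇨ a)` is `b ⇨ a`.
  have key : (a ⇨ b) ⇨ (b ⇨ a) = b ⇨ a := by
    rw [hb, ha, himp_exchange, himp_himp_cancel inf_le_left, ← hb]
  rw [← himp_himp_eq_sup, key, himp_eq_one_iff]

theorem eq_one_of_pow_le {a b u : A} {k l : ℕ} (h₁ : (a ⇨ b) ^ k ≤ u) (h₂ : (b ⇨ a) ^ l ≤ u) :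
    u = 1 :=
  le_antisymm (le_one _)
    ((pow_sup_pow_eq_one (himp_sup_himp_eq_one a b) k l).ge.trans (sup_le h₁ h₂))

end WajsbergHoop

namespace MVAlgebra

variable {A : Type*} [MVAlgebra A]

theorem himp_zero_himp_zero (x : A) : (x ⇨ 0) ⇨ 0 = x := by
  rw [himp_himp_eq_sup, sup_eq_left.2 (zero_le x)]

theorem himp_zero_himp_himp_zero (x y : A) : (y ⇨ 0) ⇨ (x ⇨ 0) = x ⇨ y := by
  rw [himp_exchange, himp_zero_himp_zero]

/-- The `0`-free reduct of an MV-algebra is a Wajsberg hoop. Divisibility is the image under the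
involution `x ↦ x ⇨ 0` of the equation that expresses the join by implication. -/
instance (priority := 100) toWajsbergHoop : WajsbergHoop A where
  tanaka x y := by rw [himp_himp_eq_sup, himp_himp_eq_sup, sup_comm]
  divisibility x y := by
    refine le_antisymm ?_ (le_inf (mul_le_left' _ _) (mul_himp_le _ _))
    have h : x * (x ⇨ y) ⇨ 0 ≤ (x ⊓ y) ⇨ 0 := by
      rw [mul_comm, ← himp_himp_eq_mul_himp, ← himp_zero_himp_himp_zero x y, himp_himp_eq_sup]
      exact sup_le (himp_le_himp_of_le inf_le_right le_rfl) (himp_le_himp_of_le inf_le_left le_rfl)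
    have := himp_le_himp_of_le h (le_refl (0 : A))
    rwa [himp_zero_himp_zero, himp_zero_himp_zero] at this

end MVAlgebra

/-! ### Intervals of Wajsberg hoops -/

namespace WajsbergHoop

/-- The interval `[m, 1]` of a Wajsberg hoop, with the product truncated at `m`. -/
def Interval {A : Type*} [WajsbergHoop A] (m : A) : Type _ := Set.Ici m

namespace Interval

variable {A : Type*} [WajsbergHoop A] {m : A}

instance : Lattice (Interval m) := inferInstanceAs (Lattice (Set.Ici m))

instance : CommMonoid (Interval m) where
  mul x y := ⟨m ⊔ x.1 * y.1, le_sup_left⟩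
  one := ⟨1, le_one m⟩
  mul_assoc x y z := by
    apply Subtype.ext
    change m ⊔ (m ⊔ x.1 * y.1) * z.1 = m ⊔ x.1 * (m ⊔ y.1 * z.1)
    apply le_antisymm
    · refine sup_le le_sup_left ?_
      rw [mul_comm]
      refine (mul_sup_le _ _ _).trans (sup_le ((mul_le_right' _ _).trans le_sup_left) ?_)
      rw [mul_comm, mul_assoc]
      exact (mul_le_mul_of_le le_rfl le_sup_right).trans le_sup_right
    · refine sup_le le_sup_left ?_
      refine (mul_sup_le _ _ _).trans (sup_le ((mul_le_right' _ _).trans le_sup_left) ?_)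
      rw [← mul_assoc]
      exact (mul_le_mul_of_le le_sup_right le_rfl).trans le_sup_right
  mul_comm x y := Subtype.ext (by change m ⊔ x.1 * y.1 = m ⊔ y.1 * x.1; rw [mul_comm])
  one_mul x := Subtype.ext (by
    change m ⊔ 1 * x.1 = x.1
    rw [one_mul]
    exact sup_eq_right.2 x.2)
  mul_one x := Subtype.ext (by
    change m ⊔ x.1 * 1 = x.1
    rw [mul_one]
    exact sup_eq_right.2 x.2)

instance : CommIntegralResiduatedLattice (Interval m) where
  himp x y := ⟨x.1 ⇨ y.1, y.2.trans (le_himp_self _ _)⟩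
  mul_le_iff_le_himp x y z := by
    change m ⊔ x.1 * y.1 ≤ z.1 ↔ y.1 ≤ x.1 ⇨ z.1
    rw [← mul_le_iff_le_himp]
    exact ⟨fun h => le_sup_right.trans h, fun h => sup_le z.2 h⟩
  le_one x := le_one x.1

instance : MVAlgebra (Interval m) where
  zero := ⟨m, le_refl m⟩
  zero_le x := x.2
  himp_himp_eq_sup x y := Subtype.ext (himp_himp_eq_sup x.1 y.1)

end Interval

end WajsbergHoop

/-- A lower bound for the values of all subterms of a term: the product of the values of all
occurrences of its variables. -/
def WTerm.lowerBound {n : ℕ} {A : Type*} [CommIntegralResiduatedLattice A] (v : Fin n → A) :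
    WTerm n → A
  | .var i => v i
  | .one => 1
  | .mul a b | .imp a b | .inf a b | .sup a b => a.lowerBound v * b.lowerBound v

theorem WTerm.lowerBound_le_eval {n : ℕ} {A : Type*} [CommIntegralResiduatedLattice A]
    (v : Fin n → A) : ∀ t : WTerm n, t.lowerBound v ≤ t.eval v
  | .var _ => le_rfl
  | .one => le_rfl
  | .mul a b => mul_le_mul_of_le (a.lowerBound_le_eval v) (b.lowerBound_le_eval v)
  | .imp _ b => (mul_le_right' _ _).trans ((b.lowerBound_le_eval v).trans (le_himp_self _ _))
  | .inf a b => le_inf ((mul_le_left' _ _).trans (a.lowerBound_le_eval v))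
      ((mul_le_right' _ _).trans (b.lowerBound_le_eval v))
  | .sup a _ => (mul_le_left' _ _).trans ((a.lowerBound_le_eval v).trans le_sup_left)

/-- Above a lower bound of all subterm values the truncation of the product is not noticed. -/
theorem WTerm.eval_interval {n : ℕ} {A : Type*} [WajsbergHoop A] (v : Fin n → A) (m : A)
    (w : Fin n → WajsbergHoop.Interval m) (hw : ∀ i, m ≤ v i → (w i).1 = v i) :
    ∀ t : WTerm n, m ≤ t.lowerBound v → (t.eval w).1 = t.eval v
  | .var i, h => hw i h
  | .one, _ => rfl
  | .mul a b, h => by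
    have ha := a.eval_interval v m w hw (h.trans (mul_le_left' _ _))
    have hb := b.eval_interval v m w hw (h.trans (mul_le_right' _ _))
    change m ⊔ (a.eval w).1 * (b.eval w).1 = a.eval v * b.eval v
    rw [ha, hb]
    exact sup_eq_right.2 (h.trans ((WTerm.mul a b).lowerBound_le_eval v))
  | .imp a b, h => by
    have ha := a.eval_interval v m w hw (h.trans (mul_le_left' _ _))
    have hb := b.eval_interval v m w hw (h.trans (mul_le_right' _ _))
    change (a.eval w).1 ⇨ (b.eval w).1 = a.eval v ⇨ b.eval v
    rw [ha, hb]
  | .inf a b, h => by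
    have ha := a.eval_interval v m w hw (h.trans (mul_le_left' _ _))
    have hb := b.eval_interval v m w hw (h.trans (mul_le_right' _ _))
    change (a.eval w).1 ⊓ (b.eval w).1 = a.eval v ⊓ b.eval v
    rw [ha, hb]
  | .sup a b, h => by
    have ha := a.eval_interval v m w hw (h.trans (mul_le_left' _ _))
    have hb := b.eval_interval v m w hw (h.trans (mul_le_right' _ _))
    change (a.eval w).1 ⊔ (b.eval w).1 = a.eval v ⊔ b.eval v
    rw [ha, hb]

/-! ### The ordered group of an MV-chain -/

namespace WajsbergHoop

variable {A : Type*} [WajsbergHoop A] {a c d : A}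

/-! Three identities which say that Chang's addition is associative; the element `d` is the
complement of the middle summand. -/

theorem himp_himp_comm_of_le (ha : d ≤ a) (hc : d ≤ c) : (a ⇨ d) ⇨ c = (c ⇨ d) ⇨ a := by
  conv_lhs => rw [← himp_himp_cancel hc, himp_exchange, himp_himp_cancel ha]

theorem mul_himp_eq_himp_himp (ha : a ≤ d) (hc : d ≤ c) : c * (d ⇨ a) = (c ⇨ d) ⇨ a := by
  have h : (c ⇨ d) ⇨ a ≤ c := by
    have := himp_le_himp_of_le (le_refl (c ⇨ d)) ha
    rwa [himp_himp_cancel hc] at this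
  rw [← mul_himp_cancel h, himp_himp_eq_mul_himp, mul_himp_cancel hc]

theorem himp_mul_comm_of_le (ha : a ≤ d) (hc : c ≤ d) : (d ⇨ a) * c = a * (d ⇨ c) := by
  conv_lhs => rw [← mul_himp_cancel hc, ← mul_assoc, mul_comm (d ⇨ a), mul_himp_cancel ha]

end WajsbergHoop

open WajsbergHoop

namespace MVAlgebra

variable {B : Type*} [MVAlgebra B]

/-- The strong disjunction of an MV-algebra, truncated addition in the standard algebra. -/
def oplus (a b : B) : B := (a ⇨ 0) ⇨ b

theorem oplus_comm (a b : B) : oplus a b = oplus b a := by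
  rw [oplus, oplus, ← himp_zero_himp_himp_zero (a ⇨ 0) b, himp_zero_himp_zero]

theorem oplus_assoc (a b c : B) : oplus (oplus a b) c = oplus a (oplus b c) := by
  rw [oplus_comm (oplus a b), oplus_comm b]
  exact himp_exchange _ _ _

theorem mul_oplus (a b c : B) : oplus (a * b) c = (a ⇨ (b ⇨ 0)) ⇨ c := by
  rw [oplus, himp_himp_eq_mul_himp]

theorem oplus_mul (a b c : B) : oplus a (b * c) = (c ⇨ (b ⇨ 0)) ⇨ a := by
  rw [oplus_comm, mul_comm, mul_oplus]

theorem le_oplus_left (a b : B) : a ≤ oplus a b := by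
  rw [oplus_comm]; exact le_himp_self _ _

theorem le_oplus_right (a b : B) : b ≤ oplus a b := le_himp_self _ _

theorem eq_zero_of_le {a : B} (h : a ≤ 0) : a = 0 := le_antisymm h (zero_le a)

theorem zero_mul (a : B) : 0 * a = 0 := eq_zero_of_le (mul_le_left' _ _)

theorem mul_zero (a : B) : a * 0 = 0 := eq_zero_of_le (mul_le_right' _ _)

theorem mul_eq_zero_iff {a b : B} : a * b = 0 ↔ a ≤ b ⇨ 0 := by
  rw [le_himp_iff_mul_le]
  exact ⟨fun h => h.le, eq_zero_of_le⟩

theorem mul_eq_zero_iff' {a b : B} : a * b = 0 ↔ b ≤ a ⇨ 0 := by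
  rw [mul_comm, mul_eq_zero_iff]

theorem eq_one_of_himp_zero_eq_zero {a : B} (h : a ⇨ 0 = 0) : a = 1 := by
  rw [← himp_zero_himp_zero a, h, himp_eq_one_iff]

section Total

variable [Std.Total (fun x y : B => x ≤ y)]

theorem himp_zero_le_of_mul_ne_zero {a b : B} (h : a * b ≠ 0) : b ⇨ 0 ≤ a :=
  (Std.Total.total (r := fun x y : B => x ≤ y) a (b ⇨ 0)).resolve_left
    fun h' => h (mul_eq_zero_iff.2 h')

theorem himp_zero_le_of_mul_ne_zero' {a b : B} (h : a * b ≠ 0) : a ⇨ 0 ≤ b :=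
  himp_zero_le_of_mul_ne_zero (by rwa [mul_comm])

end Total

end MVAlgebra

open MVAlgebra

/-- Chang's group of a totally ordered MV-algebra `B`. The pair `(k, a)` with `a ≠ 0` stands for
`k` times the order unit plus `a`, where `a` is measured downwards from `1`, so that `B` is the
interval from minus the unit to `0`; excluding `a = 0` makes this representation unique. -/
@[ext] structure ChangGroup (B : Type*) [MVAlgebra B] where
  level : ℤ
  val : B
  ne : val ≠ 0

namespace ChangGroup

variable {B : Type*} [MVAlgebra B]

open Classical in
/-- A product that is truncated to `0` is replaced by a sum one level below. -/
noncomputable instance : Add (ChangGroup B) where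
  add p q :=
    if h : p.val * q.val = 0 then
      ⟨p.level + q.level - 1, oplus p.val q.val,
        fun h' => p.ne (eq_zero_of_le (h' ▸ le_oplus_left p.val q.val))⟩
    else ⟨p.level + q.level, p.val * q.val, h⟩

section add

variable {p q : ChangGroup B}

theorem add_of_eq (h : p.val * q.val = 0) :
    p + q = ⟨p.level + q.level - 1, oplus p.val q.val,
      fun h' => p.ne (eq_zero_of_le (h' ▸ le_oplus_left p.val q.val))⟩ := dif_pos h

theorem add_of_ne (h : p.val * q.val ≠ 0) : p + q = ⟨p.level + q.level, p.val * q.val, h⟩ :=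
  dif_neg h

theorem level_add_of_eq (h : p.val * q.val = 0) : (p + q).level = p.level + q.level - 1 :=
  congrArg level (add_of_eq h)

theorem val_add_of_eq (h : p.val * q.val = 0) : (p + q).val = oplus p.val q.val :=
  congrArg val (add_of_eq h)

theorem level_add_of_ne (h : p.val * q.val ≠ 0) : (p + q).level = p.level + q.level :=
  congrArg level (add_of_ne h)

theorem val_add_of_ne (h : p.val * q.val ≠ 0) : (p + q).val = p.val * q.val :=
  congrArg val (add_of_ne h)

end add

theorem add_comm' (p q : ChangGroup B) : p + q = q + p := by
  by_cases h : p.val * q.val = 0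
  · have h' : q.val * p.val = 0 := by rwa [mul_comm]
    ext
    · rw [level_add_of_eq h, level_add_of_eq h']; ring
    · rw [val_add_of_eq h, val_add_of_eq h', oplus_comm]
  · have h' : q.val * p.val ≠ 0 := by rwa [mul_comm]
    ext
    · rw [level_add_of_ne h, level_add_of_ne h']; ring
    · rw [val_add_of_ne h, val_add_of_ne h', mul_comm]

section Total

variable [Std.Total (fun x y : B => x ≤ y)]

theorem add_assoc_of_eq_of_ne {p q r : ChangGroup B} (h₁ : p.val * q.val = 0)
    (h₂ : q.val * r.val ≠ 0) : p + q + r = p + (q + r) := by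
  have key : (p + q).val * r.val = oplus p.val (q.val * r.val) := by
    rw [val_add_of_eq h₁, oplus_mul, oplus_comm, oplus, mul_comm]
    exact mul_himp_eq_himp_himp (mul_eq_zero_iff.1 h₁) (himp_zero_le_of_mul_ne_zero' h₂)
  have h₃ : (p + q).val * r.val ≠ 0 := fun h =>
    p.ne (eq_zero_of_le ((le_oplus_left _ _).trans (key.symm.trans h).le))
  have h₄ : p.val * (q + r).val = 0 := by
    rw [val_add_of_ne h₂, ← mul_assoc, h₁, MVAlgebra.zero_mul]
  ext
  · rw [level_add_of_ne h₃, level_add_of_eq h₁, level_add_of_eq h₄, level_add_of_ne h₂]; ring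
  · rw [val_add_of_ne h₃, val_add_of_eq h₄, key, val_add_of_ne h₂]

/-- The four cases are the possible truncations of the two inner products. -/
theorem add_assoc' (p q r : ChangGroup B) : p + q + r = p + (q + r) := by
  by_cases h₁ : p.val * q.val = 0 <;> by_cases h₂ : q.val * r.val = 0
  · have key : (p + q).val * r.val = p.val * (q + r).val := by
      rw [val_add_of_eq h₁, val_add_of_eq h₂, oplus_comm, oplus, oplus]
      exact himp_mul_comm_of_le (mul_eq_zero_iff.1 h₁) (mul_eq_zero_iff'.1 h₂)
    by_cases h₃ : (p + q).val * r.val = 0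
    · have h₄ := key.symm.trans h₃
      ext
      · rw [level_add_of_eq h₃, level_add_of_eq h₁, level_add_of_eq h₄, level_add_of_eq h₂]; ring
      · rw [val_add_of_eq h₃, val_add_of_eq h₁, val_add_of_eq h₄, val_add_of_eq h₂, oplus_assoc]
    · have h₄ : p.val * (q + r).val ≠ 0 := key ▸ h₃
      ext
      · rw [level_add_of_ne h₃, level_add_of_eq h₁, level_add_of_ne h₄, level_add_of_eq h₂]; ring
      · rw [val_add_of_ne h₃, val_add_of_ne h₄, key]
  · exact add_assoc_of_eq_of_ne h₁ h₂
  · rw [add_comm' (p + q), add_comm' p q, add_comm' p, add_comm' q r]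
    exact (add_assoc_of_eq_of_ne (by rwa [mul_comm]) (by rwa [mul_comm])).symm
  · have key : (p + q).val * r.val = p.val * (q + r).val := by
      rw [val_add_of_ne h₁, val_add_of_ne h₂, mul_assoc]
    by_cases h₃ : (p + q).val * r.val = 0
    · have h₄ := key.symm.trans h₃
      ext
      · rw [level_add_of_eq h₃, level_add_of_ne h₁, level_add_of_eq h₄, level_add_of_ne h₂]; ring
      · rw [val_add_of_eq h₃, val_add_of_ne h₁, val_add_of_eq h₄, val_add_of_ne h₂, mul_oplus,
          oplus_mul]
        exact himp_himp_comm_of_le (himp_zero_le_of_mul_ne_zero h₁)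
          (himp_zero_le_of_mul_ne_zero' h₂)
    · have h₄ : p.val * (q + r).val ≠ 0 := key ▸ h₃
      ext
      · rw [level_add_of_ne h₃, level_add_of_ne h₁, level_add_of_ne h₄, level_add_of_ne h₂]; ring
      · rw [val_add_of_ne h₃, val_add_of_ne h₄, key]

open Classical in
/-- The lexicographic order. -/
noncomputable instance : LinearOrder (ChangGroup B) where
  le p q := p.level < q.level ∨ (p.level = q.level ∧ p.val ≤ q.val)
  le_refl p := Or.inr ⟨rfl, le_rfl⟩
  le_trans p q r := by
    rintro (h | ⟨h, h'⟩) (k | ⟨k, k'⟩)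
    · exact Or.inl (h.trans k)
    · exact Or.inl (k ▸ h)
    · exact Or.inl (h ▸ k)
    · exact Or.inr ⟨h.trans k, h'.trans k'⟩
  le_antisymm p q := by
    rintro (h | ⟨h, h'⟩) (k | ⟨k, k'⟩)
    · exact absurd h k.asymm
    · omega
    · omega
    · exact ChangGroup.ext h (le_antisymm h' k')
  le_total p q := by
    rcases lt_trichotomy p.level q.level with h | h | h
    · exact Or.inl (Or.inl h)
    · exact (Std.Total.total (r := fun x y : B => x ≤ y) p.val q.val).imp
        (fun h' => Or.inr ⟨h, h'⟩) (fun h' => Or.inr ⟨h.symm, h'⟩)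
    · exact Or.inr (Or.inl h)
  toDecidableLE := Classical.decRel _

theorem le_def {p q : ChangGroup B} :
    p ≤ q ↔ p.level < q.level ∨ (p.level = q.level ∧ p.val ≤ q.val) := Iff.rfl

theorem add_le_add_of_le (p q : ChangGroup B) (h : p ≤ q) (r : ChangGroup B) :
    p + r ≤ q + r := by
  rw [le_def] at h ⊢
  by_cases h₁ : p.val * r.val = 0 <;> by_cases h₂ : q.val * r.val = 0
  · rw [level_add_of_eq h₁, level_add_of_eq h₂, val_add_of_eq h₁, val_add_of_eq h₂]
    rcases h with h | ⟨h, h'⟩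
    · exact Or.inl (by omega)
    · refine Or.inr ⟨by omega, ?_⟩
      rw [oplus_comm, oplus_comm q.val]
      exact himp_le_himp_of_le le_rfl h'
  · rw [level_add_of_eq h₁, level_add_of_ne h₂]
    exact Or.inl (by omega)
  · rw [level_add_of_ne h₁, level_add_of_eq h₂, val_add_of_ne h₁, val_add_of_eq h₂]
    rcases h with h | ⟨h, h'⟩
    · rcases (show p.level + r.level ≤ q.level + r.level - 1 by omega).lt_or_eq with h | h
      · exact Or.inl h
      · exact Or.inr ⟨h, (mul_le_right' _ _).trans (le_oplus_right _ _)⟩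
    · exact absurd (eq_zero_of_le ((mul_le_mul_of_le h' le_rfl).trans h₂.le)) h₁
  · rw [level_add_of_ne h₁, level_add_of_ne h₂, val_add_of_ne h₁, val_add_of_ne h₂]
    rcases h with h | ⟨h, h'⟩
    · exact Or.inl (by omega)
    · exact Or.inr ⟨by omega, mul_le_mul_of_le h' le_rfl⟩

end Total

section Group

variable [NeZero (1 : B)]

instance : Zero (ChangGroup B) := ⟨⟨0, 1, NeZero.ne 1⟩⟩

theorem zero_add' (p : ChangGroup B) : 0 + p = p := by
  have e : (0 : ChangGroup B).val * p.val = p.val := one_mul p.val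
  have h : (0 : ChangGroup B).val * p.val ≠ 0 := by rw [e]; exact p.ne
  ext
  · rw [level_add_of_ne h]; exact zero_add _
  · rw [val_add_of_ne h, e]

open Classical in
noncomputable instance : Neg (ChangGroup B) where
  neg p := if h : p.val ⇨ 0 = 0 then ⟨-p.level, 1, NeZero.ne 1⟩ else ⟨1 - p.level, p.val ⇨ 0, h⟩

theorem add_neg' (p : ChangGroup B) : p + -p = 0 := by
  by_cases h : p.val ⇨ 0 = 0
  · have e : -p = ⟨-p.level, 1, NeZero.ne 1⟩ := dif_pos h
    rw [e]
    have h' : p.val * (1 : B) ≠ 0 := by rw [mul_one]; exact p.ne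
    ext
    · rw [level_add_of_ne h']; exact add_neg_cancel _
    · rw [val_add_of_ne h', mul_one]; exact eq_one_of_himp_zero_eq_zero h
  · have e : -p = ⟨1 - p.level, p.val ⇨ 0, h⟩ := dif_neg h
    rw [e]
    have h' : p.val * (p.val ⇨ 0) = 0 := eq_zero_of_le (mul_himp_le _ _)
    ext
    · rw [level_add_of_eq h']; change p.level + (1 - p.level) - 1 = 0; ring
    · rw [val_add_of_eq h']; exact himp_eq_one_iff.2 le_rfl

open Classical in
/-- The embedding of an MV-chain onto the interval from minus the order unit to `0`. -/
noncomputable def ofMV (a : B) : ChangGroup B :=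
  if h : a = 0 then ⟨-1, 1, NeZero.ne 1⟩ else ⟨0, a, h⟩

theorem ofMV_zero : ofMV (0 : B) = ⟨-1, 1, NeZero.ne 1⟩ := dif_pos rfl

theorem ofMV_of_ne {a : B} (h : a ≠ 0) : ofMV a = ⟨0, a, h⟩ := dif_neg h

theorem ofMV_one : ofMV (1 : B) = 0 := ofMV_of_ne (NeZero.ne 1)

theorem ofMV_injective : Function.Injective (ofMV : B → ChangGroup B) := by
  intro a b h
  by_cases ha : a = 0 <;> by_cases hb : b = 0
  · rw [ha, hb]
  · rw [ha, ofMV_zero, ofMV_of_ne hb] at h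
    exact absurd (congrArg level h) (by norm_num)
  · rw [hb, ofMV_zero, ofMV_of_ne ha] at h
    exact absurd (congrArg level h) (by norm_num)
  · rw [ofMV_of_ne ha, ofMV_of_ne hb] at h
    exact congrArg val h

theorem ofMV_add_of_ne {a b : B} (h : a * b ≠ 0) : ofMV a + ofMV b = ofMV (a * b) := by
  have ha : a ≠ 0 := fun e => h (by rw [e, MVAlgebra.zero_mul])
  have hb : b ≠ 0 := fun e => h (by rw [e, MVAlgebra.mul_zero])
  rw [ofMV_of_ne ha, ofMV_of_ne hb, ofMV_of_ne h]
  exact ChangGroup.ext (level_add_of_ne (p := ⟨0, a, ha⟩) (q := ⟨0, b, hb⟩) h)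
    (val_add_of_ne (p := ⟨0, a, ha⟩) (q := ⟨0, b, hb⟩) h)

variable [Std.Total (fun x y : B => x ≤ y)]

noncomputable instance : AddCommGroup (ChangGroup B) where
  add_assoc := add_assoc'
  zero_add := zero_add'
  add_zero p := (add_comm' p 0).trans (zero_add' p)
  neg_add_cancel p := (add_comm' _ p).trans (add_neg' p)
  add_comm := add_comm'
  nsmul := nsmulRec
  zsmul := zsmulRec

instance : IsOrderedAddMonoid (ChangGroup B) where
  add_le_add_left := add_le_add_of_le

theorem ofMV_mono : Monotone (ofMV : B → ChangGroup B) := by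
  intro a b h
  by_cases hb : b = 0
  · have ha : a = 0 := eq_zero_of_le (hb ▸ h)
    rw [ha, hb]
  · rw [ofMV_of_ne hb]
    by_cases ha : a = 0
    · rw [ha, ofMV_zero]
      exact Or.inl (by norm_num)
    · rw [ofMV_of_ne ha]
      exact Or.inr ⟨rfl, h⟩

theorem ofMV_nonpos (a : B) : ofMV a ≤ 0 := ofMV_one (B := B) ▸ ofMV_mono (le_one a)

theorem ofMV_mul (a b : B) : ofMV (a * b) = max (ofMV 0) (ofMV a + ofMV b) := by
  by_cases h : a * b = 0
  · rw [h, eq_comm, max_eq_left_iff]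
    by_cases ha : a = 0
    · rw [ha]
      exact add_le_of_nonpos_right (ofMV_nonpos b)
    by_cases hb : b = 0
    · rw [hb]
      exact add_le_of_nonpos_left (ofMV_nonpos a)
    rw [ofMV_of_ne ha, ofMV_of_ne hb, ofMV_zero, le_def]
    exact Or.inr ⟨level_add_of_eq (p := ⟨0, a, ha⟩) (q := ⟨0, b, hb⟩) h, le_one _⟩
  · rw [ofMV_add_of_ne h, eq_comm, max_eq_right_iff]
    exact ofMV_mono (zero_le _)

theorem ofMV_add_ofMV_himp {a b : B} (h : b ≤ a) : ofMV a + ofMV (a ⇨ b) = ofMV b := by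
  have e : a * (a ⇨ b) = b := mul_himp_cancel h
  by_cases hb : b = 0
  · subst hb
    by_cases ha : a = 0
    · rw [ha, himp_eq_one_iff.2 le_rfl, ofMV_one, add_zero]
    by_cases ha' : a ⇨ 0 = 0
    · rw [ha', eq_one_of_himp_zero_eq_zero ha', ofMV_one, zero_add]
    rw [ofMV_of_ne ha, ofMV_of_ne ha', ofMV_zero]
    refine ChangGroup.ext (level_add_of_eq (p := ⟨0, a, ha⟩) (q := ⟨0, a ⇨ 0, ha'⟩) e) ?_
    rw [val_add_of_eq (p := ⟨0, a, ha⟩) (q := ⟨0, a ⇨ 0, ha'⟩) e]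
    exact himp_eq_one_iff.2 le_rfl
  · rw [ofMV_add_of_ne (e.symm ▸ hb), e]

theorem ofMV_himp (a b : B) : ofMV (a ⇨ b) = min 0 (ofMV b - ofMV a) := by
  rcases Std.Total.total (r := fun x y : B => x ≤ y) a b with h | h
  · rw [himp_eq_one_iff.2 h, ofMV_one, eq_comm, min_eq_left_iff, sub_nonneg]
    exact ofMV_mono h
  · rw [← ofMV_add_ofMV_himp h, add_sub_cancel_left, eq_comm, min_eq_right_iff]
    exact ofMV_nonpos _

theorem ofMV_inf (a b : B) : ofMV (a ⊓ b) = min (ofMV a) (ofMV b) := by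
  rcases Std.Total.total (r := fun x y : B => x ≤ y) a b with h | h
  · rw [inf_eq_left.2 h, min_eq_left (ofMV_mono h)]
  · rw [inf_eq_right.2 h, min_eq_right (ofMV_mono h)]

theorem ofMV_sup (a b : B) : ofMV (a ⊔ b) = max (ofMV a) (ofMV b) := by
  rcases Std.Total.total (r := fun x y : B => x ≤ y) a b with h | h
  · rw [sup_eq_right.2 h, max_eq_right (ofMV_mono h)]
  · rw [sup_eq_left.2 h, max_eq_left (ofMV_mono h)]

end Group

end ChangGroup

/-! ### From an MV-chain to the standard algebra -/

open FourierMotzkin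

/-- The Łukasiewicz operations on an ordered group: the value of a term on the interval `[x 0, 0]`,
where `0` plays the part of the unit of the algebra and `x 0 ≤ 0` that of its bottom element, and
the variables take the remaining values of `x`. -/
def WTerm.groupEval {n : ℕ} {H : Type*} [AddCommGroup H] [LinearOrder H] (x : Fin (n + 1) → H) :
    WTerm n → H
  | .var i => x i.succ
  | .one => 0
  | .mul a b => max (x 0) (a.groupEval x + b.groupEval x)
  | .imp a b => min 0 (b.groupEval x - a.groupEval x)
  | .inf a b => min (a.groupEval x) (b.groupEval x)
  | .sup a b => max (a.groupEval x) (b.groupEval x)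

theorem ChangGroup.ofMV_eval {n : ℕ} {B : Type*} [MVAlgebra B] [NeZero (1 : B)]
    [Std.Total (fun x y : B => x ≤ y)] (v : Fin n → B) : ∀ t : WTerm n,
      ofMV (t.eval v) = t.groupEval (Fin.cons (ofMV 0) (fun i => ofMV (v i)))
  | .var _ => rfl
  | .one => ofMV_one
  | .mul a b => by
    rw [WTerm.eval, WTerm.groupEval, ofMV_mul, ofMV_eval v a, ofMV_eval v b, Fin.cons_zero]
  | .imp a b => by rw [WTerm.eval, WTerm.groupEval, ofMV_himp, ofMV_eval v a, ofMV_eval v b]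
  | .inf a b => by rw [WTerm.eval, WTerm.groupEval, ofMV_inf, ofMV_eval v a, ofMV_eval v b]
  | .sup a b => by rw [WTerm.eval, WTerm.groupEval, ofMV_sup, ofMV_eval v a, ofMV_eval v b]

/-- On the region, given by finitely many linear inequalities, where all comparisons between
values of subterms come out as they do at `x`, the value of a term is a linear form. -/
theorem WTerm.exists_form {n : ℕ} {G : Type*} [AddCommGroup G] [LinearOrder G]
    [IsOrderedAddMonoid G] (x : Fin (n + 1) → G) (t : WTerm n) :
    ∃ (S : Set (Fin (n + 1) → ℤ)) (l : Fin (n + 1) → ℤ), S.Finite ∧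
      ((∀ c ∈ S, 0 ≤ form c x) ∧ t.groupEval x = form l x) ∧
      ∀ y : Fin (n + 1) → ℝ, (∀ c ∈ S, 0 ≤ form c y) → t.groupEval y = form l y := by
  -- The maximum and the minimum of two forms are linear where the comparison at `x` persists.
  have hmax : ∀ l₁ l₂ : Fin (n + 1) → ℤ, ∃ c l, (0 ≤ form c x ∧
      max (form l₁ x) (form l₂ x) = form l x) ∧
      ∀ y : Fin (n + 1) → ℝ, 0 ≤ form c y → max (form l₁ y) (form l₂ y) = form l y := by
    intro l₁ l₂
    rcases le_total (form l₁ x) (form l₂ x) with h | h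
    · refine ⟨l₂ - l₁, l₂, ⟨?_, max_eq_right h⟩, fun y hy => max_eq_right ?_⟩
      · rwa [form_sub, sub_nonneg]
      · rwa [form_sub, sub_nonneg] at hy
    · refine ⟨l₁ - l₂, l₁, ⟨?_, max_eq_left h⟩, fun y hy => max_eq_left ?_⟩
      · rwa [form_sub, sub_nonneg]
      · rwa [form_sub, sub_nonneg] at hy
  have hmin : ∀ l₁ l₂ : Fin (n + 1) → ℤ, ∃ c l, (0 ≤ form c x ∧
      min (form l₁ x) (form l₂ x) = form l x) ∧
      ∀ y : Fin (n + 1) → ℝ, 0 ≤ form c y → min (form l₁ y) (form l₂ y) = form l y := by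
    intro l₁ l₂
    rcases le_total (form l₁ x) (form l₂ x) with h | h
    · refine ⟨l₂ - l₁, l₁, ⟨?_, min_eq_left h⟩, fun y hy => min_eq_left ?_⟩
      · rwa [form_sub, sub_nonneg]
      · rwa [form_sub, sub_nonneg] at hy
    · refine ⟨l₁ - l₂, l₂, ⟨?_, min_eq_right h⟩, fun y hy => min_eq_right ?_⟩
      · rwa [form_sub, sub_nonneg]
      · rwa [form_sub, sub_nonneg] at hy
  induction t with
  | var i =>
    exact ⟨∅, Pi.single i.succ 1, Set.finite_empty, ⟨by simp, (form_single _ _).symm⟩,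
      fun y _ => (form_single _ _).symm⟩
  | one => exact ⟨∅, 0, Set.finite_empty, ⟨by simp, (form_zero _).symm⟩,
      fun y _ => (form_zero _).symm⟩
  | mul a b iha ihb =>
    obtain ⟨S, k, hS, ⟨h₁, h₂⟩, h₃⟩ := iha
    obtain ⟨T, l, hT, ⟨h₄, h₅⟩, h₆⟩ := ihb
    obtain ⟨c, m, ⟨h₇, h₈⟩, h₉⟩ := hmax (Pi.single 0 1) (k + l)
    refine ⟨insert c (S ∪ T), m, (hS.union hT).insert c, ⟨?_, ?_⟩, fun y hy => ?_⟩
    · rintro d (rfl | hd | hd)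
      exacts [h₇, h₁ d hd, h₄ d hd]
    · rw [← h₈, form_single, form_add, groupEval, h₂, h₅]
    · rw [← h₉ y (hy c (by simp)), form_single, form_add, groupEval,
        h₃ y fun d hd => hy d (by simp [hd]), h₆ y fun d hd => hy d (by simp [hd])]
  | imp a b iha ihb =>
    obtain ⟨S, k, hS, ⟨h₁, h₂⟩, h₃⟩ := iha
    obtain ⟨T, l, hT, ⟨h₄, h₅⟩, h₆⟩ := ihb
    obtain ⟨c, m, ⟨h₇, h₈⟩, h₉⟩ := hmin 0 (l - k)
    refine ⟨insert c (S ∪ T), m, (hS.union hT).insert c, ⟨?_, ?_⟩, fun y hy => ?_⟩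
    · rintro d (rfl | hd | hd)
      exacts [h₇, h₁ d hd, h₄ d hd]
    · rw [← h₈, form_zero, form_sub, groupEval, h₂, h₅]
    · rw [← h₉ y (hy c (by simp)), form_zero, form_sub, groupEval,
        h₃ y fun d hd => hy d (by simp [hd]), h₆ y fun d hd => hy d (by simp [hd])]
  | inf a b iha ihb =>
    obtain ⟨S, k, hS, ⟨h₁, h₂⟩, h₃⟩ := iha
    obtain ⟨T, l, hT, ⟨h₄, h₅⟩, h₆⟩ := ihb
    obtain ⟨c, m, ⟨h₇, h₈⟩, h₉⟩ := hmin k l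
    refine ⟨insert c (S ∪ T), m, (hS.union hT).insert c, ⟨?_, ?_⟩, fun y hy => ?_⟩
    · rintro d (rfl | hd | hd)
      exacts [h₇, h₁ d hd, h₄ d hd]
    · rw [← h₈, groupEval, h₂, h₅]
    · rw [← h₉ y (hy c (by simp)), groupEval,
        h₃ y fun d hd => hy d (by simp [hd]), h₆ y fun d hd => hy d (by simp [hd])]
  | sup a b iha ihb =>
    obtain ⟨S, k, hS, ⟨h₁, h₂⟩, h₃⟩ := iha
    obtain ⟨T, l, hT, ⟨h₄, h₅⟩, h₆⟩ := ihb
    obtain ⟨c, m, ⟨h₇, h₈⟩, h₉⟩ := hmax k l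
    refine ⟨insert c (S ∪ T), m, (hS.union hT).insert c, ⟨?_, ?_⟩, fun y hy => ?_⟩
    · rintro d (rfl | hd | hd)
      exacts [h₇, h₁ d hd, h₄ d hd]
    · rw [← h₈, groupEval, h₂, h₅]
    · rw [← h₉ y (hy c (by simp)), groupEval,
        h₃ y fun d hd => hy d (by simp [hd]), h₆ y fun d hd => hy d (by simp [hd])]

/-- A counterexample in an ordered group yields one in the additive group of the reals. -/
theorem WTerm.exists_real_groupEval {n : ℕ} {G : Type*} [AddCommGroup G] [LinearOrder G]
    [IsOrderedAddMonoid G] (x : Fin (n + 1) → G) (t u : WTerm n)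
    (hx : ∀ i : Fin n, x 0 ≤ x i.succ ∧ x i.succ ≤ 0) (hx0 : x 0 ≤ 0) (ht : t.groupEval x = 0)
    (hu : u.groupEval x < 0) :
    ∃ y : Fin (n + 1) → ℝ, (∀ i : Fin n, y 0 ≤ y i.succ ∧ y i.succ ≤ 0) ∧ y 0 ≤ 0 ∧
      t.groupEval y = 0 ∧ u.groupEval y < 0 := by
  obtain ⟨S, k, hS, ⟨hS₁, hk⟩, hS₂⟩ := t.exists_form x
  obtain ⟨T, l, hT, ⟨hT₁, hl⟩, hT₂⟩ := u.exists_form x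
  rw [hk] at ht
  rw [hl] at hu
  -- The nonstrict inequalities of the system; the only strict one is `0 < -l`.
  let E : Set (Fin (n + 1) → ℤ) := S ∪ T ∪
    (Set.range fun i : Fin n => Pi.single i.succ 1 - Pi.single 0 1) ∪
    (Set.range fun i : Fin n => -Pi.single i.succ 1) ∪ {-Pi.single 0 1, k, -k}
  have hE : E.Finite := (((hS.union hT).union (Set.finite_range _)).union
    (Set.finite_range _)).union (by simp)
  obtain ⟨y, hy⟩ := exists_real_solution (S := insert (-l, true) ((fun c => (c, false)) '' E))
    ((hE.image _).insert _) x (by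
      rintro c (rfl | ⟨c, hc, rfl⟩)
      · simp only [Holds, form_neg]
        exact ⟨neg_nonneg.2 hu.le, fun _ => neg_pos.2 hu⟩
      · refine ⟨?_, fun h => absurd h (by simp)⟩
        rcases hc with ((((hc | hc) | ⟨i, rfl⟩) | ⟨i, rfl⟩) | rfl | rfl | rfl)
        · exact hS₁ c hc
        · exact hT₁ c hc
        · simpa only [form_sub, form_single, sub_nonneg] using (hx i).1
        · simpa only [form_neg, form_single, neg_nonneg] using (hx i).2
        · simpa only [form_neg, form_single, neg_nonneg] using hx0
        · exact ht.ge
        · simp only [form_neg, ht, neg_zero, le_refl])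
  have hyE : ∀ c ∈ E, 0 ≤ form c y := fun c hc => (hy _ (Or.inr ⟨c, hc, rfl⟩)).1
  have hyl : 0 < form (-l) y := (hy _ (Or.inl rfl)).2 rfl
  refine ⟨y, fun i => ⟨?_, ?_⟩, ?_, ?_, ?_⟩
  · simpa only [form_sub, form_single, sub_nonneg] using
      hyE _ (Or.inl (Or.inl (Or.inr ⟨i, rfl⟩)))
  · simpa only [form_neg, form_single, neg_nonneg] using hyE _ (Or.inl (Or.inr ⟨i, rfl⟩))
  · simpa only [form_neg, form_single, neg_nonneg] using hyE (-Pi.single 0 1) (Or.inr (by simp))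
  · rw [hS₂ y fun c hc => hyE c (Or.inl (Or.inl (Or.inl (Or.inl hc))))]
    have h₁ := hyE k (Or.inr (by simp))
    have h₂ := hyE (-k) (Or.inr (by simp))
    rw [form_neg] at h₂
    linarith
  · rw [hT₂ y fun c hc => hyE c (Or.inl (Or.inl (Or.inl (Or.inr hc))))]
    rw [form_neg] at hyl
    linarith

theorem WTerm.le_groupEval {n : ℕ} {y : Fin (n + 1) → ℝ} (h0 : y 0 ≤ 0)
    (hy : ∀ i : Fin n, y 0 ≤ y i.succ ∧ y i.succ ≤ 0) :
    ∀ t : WTerm n, y 0 ≤ t.groupEval y ∧ t.groupEval y ≤ 0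
  | .var i => hy i
  | .one => ⟨h0, le_rfl⟩
  | .mul a b => ⟨le_max_left _ _, max_le h0 (add_nonpos (a.le_groupEval h0 hy).2
      (b.le_groupEval h0 hy).2)⟩
  | .imp a b => ⟨le_min h0 (by linarith [(a.le_groupEval h0 hy).2, (b.le_groupEval h0 hy).1]),
      min_le_left _ _⟩
  | .inf a b => ⟨le_min (a.le_groupEval h0 hy).1 (b.le_groupEval h0 hy).1,
      (min_le_left _ _).trans (a.le_groupEval h0 hy).2⟩
  | .sup a b => ⟨(a.le_groupEval h0 hy).1.trans (le_max_left _ _),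
      max_le (a.le_groupEval h0 hy).2 (b.le_groupEval h0 hy).2⟩

/-- The affine map of `[y 0, 0]` onto `[0, 1]` carries the operations of the former interval to
those of the standard algebra. -/
theorem WTerm.eval_stdUnit_eq {n : ℕ} {y : Fin (n + 1) → ℝ} (h0 : y 0 < 0)
    (p : Fin n → StdUnit) (hp : ∀ i, (p i).1 = 1 + y i.succ / (-y 0)) :
    ∀ t : WTerm n, (t.eval p).1 = 1 + t.groupEval y / (-y 0)
  | .var i => hp i
  | .one => by simp [groupEval]; rfl
  | .mul a b => by
    have h : (0 : ℝ) ≤ -y 0 := by linarith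
    change max 0 ((a.eval p).1 + (b.eval p).1 - 1) = _
    rw [a.eval_stdUnit_eq h0 p hp, b.eval_stdUnit_eq h0 p hp, groupEval, ← max_div_div_right h,
      ← max_add_add_left, add_div]
    congr 1
    · rw [div_neg, div_self h0.ne]; ring
    · ring
  | .imp a b => by
    have h : (0 : ℝ) ≤ -y 0 := by linarith
    change min 1 ((b.eval p).1 - (a.eval p).1 + 1) = _
    rw [a.eval_stdUnit_eq h0 p hp, b.eval_stdUnit_eq h0 p hp, groupEval, ← min_div_div_right h,
      ← min_add_add_left, sub_div]
    congr 1
    · simp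
    · ring
  | .inf a b => by
    have h : (0 : ℝ) ≤ -y 0 := by linarith
    change min (a.eval p).1 (b.eval p).1 = _
    rw [a.eval_stdUnit_eq h0 p hp, b.eval_stdUnit_eq h0 p hp, groupEval, ← min_div_div_right h,
      ← min_add_add_left]
  | .sup a b => by
    have h : (0 : ℝ) ≤ -y 0 := by linarith
    change max (a.eval p).1 (b.eval p).1 = _
    rw [a.eval_stdUnit_eq h0 p hp, b.eval_stdUnit_eq h0 p hp, groupEval, ← max_div_div_right h,
      ← max_add_add_left]

/-- A counterexample in a totally ordered MV-algebra yields one in the standard algebra. -/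
theorem exists_stdUnit_of_mvChain {n : ℕ} {B : Type*} [MVAlgebra B]
    [Std.Total (fun x y : B => x ≤ y)] (v : Fin n → B) (t u : WTerm n) (ht : t.eval v = 1)
    (hu : u.eval v ≠ 1) : ∃ p : Fin n → StdUnit, t.eval p = 1 ∧ u.eval p ≠ 1 := by
  have : NeZero (1 : B) :=
    ⟨fun h => hu (le_antisymm (le_one _) (h ▸ zero_le (u.eval v)))⟩
  obtain ⟨y, hy, h0, hyt, hyu⟩ := WTerm.exists_real_groupEval
    (Fin.cons (ChangGroup.ofMV (0 : B)) (fun i => ChangGroup.ofMV (v i))) t u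
    (fun i => ⟨ChangGroup.ofMV_mono (zero_le _), ChangGroup.ofMV_nonpos _⟩)
    (ChangGroup.ofMV_nonpos _) (by rw [← ChangGroup.ofMV_eval, ht, ChangGroup.ofMV_one])
    (by
      rw [← ChangGroup.ofMV_eval]
      refine lt_of_le_of_ne (ChangGroup.ofMV_nonpos _) fun h => hu ?_
      exact ChangGroup.ofMV_injective (h.trans ChangGroup.ofMV_one.symm))
  have h0' : y 0 < 0 := (u.le_groupEval h0 hy).1.trans_lt hyu
  have hpos : 0 < -y 0 := by linarith
  let p : Fin n → StdUnit := fun i => ⟨1 + y i.succ / (-y 0), by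
    have := (div_le_div_iff_of_pos_right hpos).2 (hy i).1
    rw [div_neg, div_self h0'.ne] at this
    linarith, by
    have := div_nonpos_of_nonpos_of_nonneg (hy i).2 hpos.le
    linarith⟩
  have hval := WTerm.eval_stdUnit_eq h0' p fun _ => rfl
  refine ⟨p, Subtype.ext ?_, fun h => ?_⟩
  · rw [hval, hyt]
    simp; rfl
  · have h' := hval u
    rw [h] at h'
    have h1 : (1 : ℝ) = 1 + u.groupEval y / (-y 0) := h'
    have := div_neg_of_neg_of_pos hyu hpos
    linarith

/-- A counterexample in a totally ordered Wajsberg hoop yields one in the standard algebra. Only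
the interval above a lower bound of all subterm values matters, and it is an MV-algebra. -/
theorem exists_stdUnit_of_wajsbergChain {n : ℕ} {A : Type*} [WajsbergHoop A]
    [Std.Total (fun x y : A => x ≤ y)] (v : Fin n → A) (t u : WTerm n) (ht : t.eval v = 1)
    (hu : u.eval v ≠ 1) : ∃ p : Fin n → StdUnit, t.eval p = 1 ∧ u.eval p ≠ 1 := by
  classical
  set m := t.lowerBound v * u.lowerBound v
  have htot : Std.Total (fun x y : Interval m => x ≤ y) :=
    ⟨fun x y => Std.Total.total (r := fun x y : A => x ≤ y) x.1 y.1⟩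
  -- Variables that do not occur in `t` or `u` may lie below `m`; their value is irrelevant.
  let w : Fin n → Interval m := fun i => if h : m ≤ v i then ⟨v i, h⟩ else 1
  have hw : ∀ i, m ≤ v i → (w i).1 = v i := fun i h =>
    congrArg Subtype.val (dif_pos h : w i = ⟨v i, h⟩)
  have h₁ := t.eval_interval v m w hw (mul_le_left' _ _)
  have h₂ := u.eval_interval v m w hw (mul_le_right' _ _)
  refine exists_stdUnit_of_mvChain w t u (Subtype.ext (h₁.trans ht)) fun h => hu ?_
  rw [← h₂, h]
  rfl

/-! ### Derivations and soundness -/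

namespace FLeDeduces

variable {F : Type*} [One F] [Mul F] [HImp F] [Min F] [Max F] {Ax Γ Δ : Set F}

/-- Induction on derivations in which the theorems of the logic form a single case. -/
theorem induction_of_premises {P : F → Prop} (base : ∀ φ, FLeDeduces Ax ∅ φ → P φ)
    (premise : ∀ φ ∈ Γ, P φ) (mp : ∀ φ ψ, P φ → P (φ ⇨ ψ) → P ψ) (adj : ∀ φ, P φ → P (φ ⊓ 1))
    {φ : F} (h : FLeDeduces Ax Γ φ) : P φ := by
  induction h with
  | ax h => exact base _ (.ax h)
  | premise h => exact premise _ h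
  | identity => exact base _ (.identity _)
  | prefixing => exact base _ (.prefixing _ _ _)
  | exchange => exact base _ (.exchange _ _ _)
  | mul_inf => exact base _ (.mul_inf _ _)
  | inf_left => exact base _ (.inf_left _ _)
  | inf_right => exact base _ (.inf_right _ _)
  | imp_inf => exact base _ (.imp_inf _ _ _)
  | sup_left => exact base _ (.sup_left _ _)
  | sup_right => exact base _ (.sup_right _ _)
  | sup_imp => exact base _ (.sup_imp _ _ _)
  | imp_mul => exact base _ (.imp_mul _ _)
  | mul_imp => exact base _ (.mul_imp _ _ _)
  | one => exact base _ .one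
  | one_imp => exact base _ (.one_imp _)
  | modusPonens _ _ h₁ h₂ => exact mp _ _ h₁ h₂
  | adjUnit _ h => exact adj _ h

theorem cut {φ : F} (h : FLeDeduces Ax Γ φ) (hΓ : ∀ ψ ∈ Γ, FLeDeduces Ax Δ ψ) : FLeDeduces Ax Δ φ := by
  induction h with
  | ax h => exact .ax h
  | premise h => exact hΓ _ h
  | identity => exact .identity _
  | prefixing => exact .prefixing _ _ _
  | exchange => exact .exchange _ _ _
  | mul_inf => exact .mul_inf _ _
  | inf_left => exact .inf_left _ _
  | inf_right => exact .inf_right _ _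
  | imp_inf => exact .imp_inf _ _ _
  | sup_left => exact .sup_left _ _
  | sup_right => exact .sup_right _ _
  | sup_imp => exact .sup_imp _ _ _
  | imp_mul => exact .imp_mul _ _
  | mul_imp => exact .mul_imp _ _ _
  | one => exact .one
  | one_imp => exact .one_imp _
  | modusPonens _ _ h₁ h₂ => exact .modusPonens h₁ h₂
  | adjUnit _ h => exact .adjUnit h

theorem mono {φ : F} (h : FLeDeduces Ax Γ φ) (hΓ : Γ ⊆ Δ) : FLeDeduces Ax Δ φ :=
  h.cut fun _ hψ => .premise (hΓ hψ)

/-- A derivation from the union of a chain of sets of premises uses only one of them. -/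
theorem exists_of_sUnion {c : Set (Set F)} (hc : IsChain (· ⊆ ·) c) (hne : c.Nonempty) {φ : F}
    (h : FLeDeduces Ax (⋃₀ c) φ) : ∃ Γ ∈ c, FLeDeduces Ax Γ φ := by
  refine induction_of_premises (P := fun φ => ∃ Γ ∈ c, FLeDeduces Ax Γ φ) (fun φ h => ?_)
    (fun φ h => ?_) (fun φ ψ h₁ h₂ => ?_) (fun φ h => ?_) h
  · obtain ⟨Γ, hΓ⟩ := hne
    exact ⟨Γ, hΓ, h.mono (Set.empty_subset _)⟩
  · obtain ⟨Γ, hΓ, h⟩ := h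
    exact ⟨Γ, hΓ, .premise h⟩
  · obtain ⟨Γ, hΓ, h₁⟩ := h₁
    obtain ⟨Δ, hΔ, h₂⟩ := h₂
    rcases hc.total hΓ hΔ with h | h
    · exact ⟨Δ, hΔ, .modusPonens (h₁.mono h) h₂⟩
    · exact ⟨Γ, hΓ, .modusPonens h₁ (h₂.mono h)⟩
  · obtain ⟨Γ, hΓ, h⟩ := h
    exact ⟨Γ, hΓ, .adjUnit h⟩

/-- The rules and axioms of the calculus preserve the value `1` in integral residuated lattices. -/
theorem sound {A : Type*} [CommIntegralResiduatedLattice A] (f : F → A) (f_one : f 1 = 1)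
    (f_mul : ∀ a b, f (a * b) = f a * f b) (f_imp : ∀ a b, f (a ⇨ b) = f a ⇨ f b)
    (f_inf : ∀ a b, f (a ⊓ b) = f a ⊓ f b) (f_sup : ∀ a b, f (a ⊔ b) = f a ⊔ f b)
    (hAx : ∀ φ ∈ Ax, f φ = 1) (hΓ : ∀ φ ∈ Γ, f φ = 1) {φ : F} (h : FLeDeduces Ax Γ φ) :
    f φ = 1 := by
  have curry : ∀ a b c : A, a ⇨ (b ⇨ c) = 1 ↔ a * b ≤ c := fun a b c => by
    rw [himp_eq_one_iff, le_himp_iff_mul_le]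
  induction h with
  | ax h => exact hAx _ h
  | premise h => exact hΓ _ h
  | identity => rw [f_imp, himp_eq_one_iff]
  | prefixing φ ψ χ =>
    simp only [f_imp]
    rw [curry, le_himp_iff_mul_le, mul_assoc, mul_comm, mul_comm (f χ ⇨ f φ)]
    exact (mul_le_mul_of_le (mul_himp_le _ _) le_rfl).trans (mul_himp_le _ _)
  | exchange φ ψ χ =>
    simp only [f_imp]
    rw [himp_exchange (f φ), himp_eq_one_iff]
  | mul_inf φ ψ =>
    simp only [f_imp, f_mul, f_inf, himp_eq_one_iff]
    exact le_inf ((mul_le_left' _ _).trans inf_le_left) ((mul_le_right' _ _).trans inf_le_left)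
  | inf_left => simp only [f_imp, f_inf, himp_eq_one_iff, inf_le_left]
  | inf_right => simp only [f_imp, f_inf, himp_eq_one_iff, inf_le_right]
  | imp_inf φ ψ χ => simp only [f_imp, f_inf, ← himp_inf_eq, himp_eq_one_iff, le_refl]
  | sup_left => simp only [f_imp, f_sup, himp_eq_one_iff, le_sup_left]
  | sup_right => simp only [f_imp, f_sup, himp_eq_one_iff, le_sup_right]
  | sup_imp φ ψ χ =>
    simp only [f_imp, f_sup, f_inf]
    rw [himp_exchange, himp_eq_one_iff]
    exact sup_le ((le_himp_himp_self _ (f χ)).trans (himp_le_himp_of_le inf_le_left le_rfl))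
      ((le_himp_himp_self _ (f χ)).trans (himp_le_himp_of_le inf_le_right le_rfl))
  | imp_mul φ ψ => simp only [f_imp, f_mul, curry, mul_comm (f φ), le_refl]
  | mul_imp φ ψ χ =>
    simp only [f_imp, f_mul]
    rw [himp_eq_one_iff, himp_exchange, himp_himp_eq_mul_himp]
  | one => exact f_one
  | one_imp => simp only [f_imp, f_one, himp_eq_one_iff.2 le_rfl]
  | modusPonens _ _ h₁ h₂ =>
    rw [f_imp, h₁, one_himp] at h₂
    exact h₂
  | adjUnit _ h => rw [f_inf, h, f_one, inf_idem]

end FLeDeduces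

/-- Soundness of positive Łukasiewicz logic for Wajsberg hoops. -/
theorem PosLukDeduces.sound {n : ℕ} {A : Type*} [WajsbergHoop A] {Γ : Set (WTerm n)} {u : WTerm n}
    (h : PosLukDeduces Γ u) (v : Fin n → A) (hΓ : ∀ φ ∈ Γ, φ.eval v = 1) : u.eval v = 1 := by
  refine FLeDeduces.sound (WTerm.eval v) rfl (fun _ _ => rfl) (fun _ _ => rfl) (fun _ _ => rfl)
    (fun _ _ => rfl) (fun φ hφ => ?_) hΓ h
  cases hφ with
  | weakening a b => exact himp_eq_one_iff.2 (le_himp_self (b.eval v) (a.eval v))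
  | tanaka a b => exact himp_eq_one_iff.2 (WajsbergHoop.tanaka (a.eval v) (b.eval v)).le
  | divisibility a b =>
    exact himp_eq_one_iff.2 (WajsbergHoop.divisibility (a.eval v) (b.eval v)).le

/-- Soundness of Łukasiewicz logic for MV-algebras. -/
theorem LukDeduces.sound {n : ℕ} {A : Type*} [MVAlgebra A] {Γ : Set (MVTerm n)} {u : MVTerm n}
    (h : LukDeduces Γ u) (v : Fin n → A) (hΓ : ∀ φ ∈ Γ, φ.eval v = 1) : u.eval v = 1 := by
  refine FLeDeduces.sound (MVTerm.eval v) rfl (fun _ _ => rfl) (fun _ _ => rfl) (fun _ _ => rfl)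
    (fun _ _ => rfl) (fun φ hφ => ?_) hΓ h
  cases hφ with
  | weakening a b => exact himp_eq_one_iff.2 (le_himp_self (b.eval v) (a.eval v))
  | exFalso a => exact himp_eq_one_iff.2 (MVAlgebra.zero_le (a.eval v))
  | lukasiewicz a b =>
    exact himp_eq_one_iff.2 (MVAlgebra.himp_himp_eq_sup (a.eval v) (b.eval v)).le

theorem WTerm.eval_toMV {n : ℕ} {A : Type*} [MVAlgebra A] (v : Fin n → A) :
    ∀ t : WTerm n, t.toMV.eval v = t.eval v
  | .var _ => rfl
  | .one => rfl
  | .mul a b => by rw [toMV, MVTerm.eval, eval, eval_toMV v a, eval_toMV v b]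
  | .imp a b => by rw [toMV, MVTerm.eval, eval, eval_toMV v a, eval_toMV v b]
  | .inf a b => by rw [toMV, MVTerm.eval, eval, eval_toMV v a, eval_toMV v b]
  | .sup a b => by rw [toMV, MVTerm.eval, eval, eval_toMV v a, eval_toMV v b]

/-! ### Lindenbaum algebras -/

namespace FLeDeduces

variable {F : Type*} [One F] [Mul F] [HImp F] [Min F] [Max F] {Ax Γ : Set F} {φ φ' ψ ψ' χ : F}

theorem imp_trans (h₁ : FLeDeduces Ax Γ (φ ⇨ ψ)) (h₂ : FLeDeduces Ax Γ (ψ ⇨ χ)) :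
    FLeDeduces Ax Γ (φ ⇨ χ) :=
  .modusPonens h₁ (.modusPonens h₂ (.prefixing _ _ _))

theorem imp_exchange (h : FLeDeduces Ax Γ (φ ⇨ (ψ ⇨ χ))) : FLeDeduces Ax Γ (ψ ⇨ (φ ⇨ χ)) :=
  .modusPonens h (.exchange _ _ _)

theorem imp_imp_imp (h₁ : FLeDeduces Ax Γ (φ' ⇨ φ)) (h₂ : FLeDeduces Ax Γ (ψ ⇨ ψ')) :
    FLeDeduces Ax Γ ((φ ⇨ ψ) ⇨ (φ' ⇨ ψ')) :=
  imp_trans (.modusPonens h₂ (.prefixing _ _ _))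
    (.modusPonens h₁ (imp_exchange (.prefixing _ _ _)))

theorem mul_imp_iff : FLeDeduces Ax Γ ((φ * ψ) ⇨ χ) ↔ FLeDeduces Ax Γ (ψ ⇨ (φ ⇨ χ)) :=
  ⟨fun h => imp_trans (.imp_mul ψ φ) (imp_imp_imp (.identity _) h),
    fun h => .modusPonens h (.mul_imp _ _ _)⟩

theorem mul_imp_mul (h₁ : FLeDeduces Ax Γ (φ ⇨ φ')) (h₂ : FLeDeduces Ax Γ (ψ ⇨ ψ')) :
    FLeDeduces Ax Γ ((φ * ψ) ⇨ (φ' * ψ')) :=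
  mul_imp_iff.2 (imp_trans (imp_trans h₂ (.imp_mul _ _)) (imp_imp_imp h₁ (.identity _)))

theorem and_intro (h₁ : FLeDeduces Ax Γ φ) (h₂ : FLeDeduces Ax Γ ψ) : FLeDeduces Ax Γ (φ ⊓ ψ) :=
  .modusPonens (.modusPonens (.adjUnit h₁) (.modusPonens (.adjUnit h₂) (.imp_mul _ _)))
    (.mul_inf _ _)

theorem imp_and (h₁ : FLeDeduces Ax Γ (φ ⇨ ψ)) (h₂ : FLeDeduces Ax Γ (φ ⇨ χ)) :
    FLeDeduces Ax Γ (φ ⇨ (ψ ⊓ χ)) :=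
  .modusPonens (and_intro h₁ h₂) (.imp_inf _ _ _)

theorem or_imp (h₁ : FLeDeduces Ax Γ (φ ⇨ χ)) (h₂ : FLeDeduces Ax Γ (ψ ⇨ χ)) :
    FLeDeduces Ax Γ ((φ ⊔ ψ) ⇨ χ) :=
  .modusPonens (and_intro h₁ h₂) (.sup_imp _ _ _)

/-- Interderivability of implications, the congruence that a set of premises defines. -/
def setoid (Ax Γ : Set F) : Setoid F where
  r φ ψ := FLeDeduces Ax Γ (φ ⇨ ψ) ∧ FLeDeduces Ax Γ (ψ ⇨ φ)
  iseqv :=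
    { refl := fun φ => ⟨.identity φ, .identity φ⟩
      symm := And.symm
      trans := fun h k => ⟨imp_trans h.1 k.1, imp_trans k.2 h.2⟩ }

end FLeDeduces

/-- The Lindenbaum algebra of a set of premises: formulas up to provable equivalence. -/
def Lindenbaum {F : Type*} [One F] [Mul F] [HImp F] [Min F] [Max F] (Ax Γ : Set F) : Type _ :=
  Quotient (FLeDeduces.setoid Ax Γ)

namespace Lindenbaum

open FLeDeduces

variable {F : Type*} [One F] [Mul F] [HImp F] [Min F] [Max F] {Ax Γ : Set F}

/-- The class of a formula. -/
def mk (Ax Γ : Set F) (φ : F) : Lindenbaum Ax Γ := Quotient.mk (FLeDeduces.setoid Ax Γ) φ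

theorem ind {P : Lindenbaum Ax Γ → Prop} (h : ∀ φ, P (mk Ax Γ φ)) (x : Lindenbaum Ax Γ) : P x :=
  Quotient.ind h x

instance : One (Lindenbaum Ax Γ) := ⟨mk Ax Γ 1⟩

instance : Mul (Lindenbaum Ax Γ) :=
  ⟨Quotient.map₂ (· * ·) fun _ _ h _ _ k => ⟨mul_imp_mul h.1 k.1, mul_imp_mul h.2 k.2⟩⟩

instance : HImp (Lindenbaum Ax Γ) :=
  ⟨Quotient.map₂ (· ⇨ ·) fun _ _ h _ _ k => ⟨imp_imp_imp h.2 k.1, imp_imp_imp h.1 k.2⟩⟩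

instance : Lattice (Lindenbaum Ax Γ) where
  le x y := Quotient.liftOn₂ x y (fun φ ψ => FLeDeduces Ax Γ (φ ⇨ ψ)) fun _ _ _ _ h k =>
    propext ⟨fun l => imp_trans h.2 (imp_trans l k.1), fun l => imp_trans h.1 (imp_trans l k.2)⟩
  le_refl := ind fun φ => .identity φ
  le_trans := ind fun _ => ind fun _ => ind fun _ h k => imp_trans h k
  le_antisymm := ind fun _ => ind fun _ h k => Quotient.sound ⟨h, k⟩
  inf := Quotient.map₂ (· ⊓ ·) fun _ _ h _ _ k =>
    ⟨imp_and (imp_trans (.inf_left _ _) h.1) (imp_trans (.inf_right _ _) k.1),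
      imp_and (imp_trans (.inf_left _ _) h.2) (imp_trans (.inf_right _ _) k.2)⟩
  inf_le_left := ind fun _ => ind fun _ => .inf_left _ _
  inf_le_right := ind fun _ => ind fun _ => .inf_right _ _
  le_inf := ind fun _ => ind fun _ => ind fun _ h k => imp_and h k
  sup := Quotient.map₂ (· ⊔ ·) fun _ _ h _ _ k =>
    ⟨or_imp (imp_trans h.1 (.sup_left _ _)) (imp_trans k.1 (.sup_right _ _)),
      or_imp (imp_trans h.2 (.sup_left _ _)) (imp_trans k.2 (.sup_right _ _))⟩
  le_sup_left := ind fun _ => ind fun _ => .sup_left _ _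
  le_sup_right := ind fun _ => ind fun _ => .sup_right _ _
  sup_le := ind fun _ => ind fun _ => ind fun _ h k => or_imp h k

theorem mk_le_mk {φ ψ : F} : mk Ax Γ φ ≤ mk Ax Γ ψ ↔ FLeDeduces Ax Γ (φ ⇨ ψ) := Iff.rfl

theorem residuation : ∀ x y z : Lindenbaum Ax Γ, x * y ≤ z ↔ y ≤ x ⇨ z :=
  ind fun _ => ind fun _ => ind fun _ => mul_imp_iff

theorem mul_comm_le : ∀ x y : Lindenbaum Ax Γ, x * y ≤ y * x :=
  ind fun _ => ind fun _ => mul_imp_iff.2 (imp_exchange (.imp_mul _ _))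

protected theorem mul_comm (x y : Lindenbaum Ax Γ) : x * y = y * x :=
  le_antisymm (mul_comm_le _ _) (mul_comm_le _ _)

theorem mul_assoc_le (x y z : Lindenbaum Ax Γ) : x * y * z ≤ x * (y * z) := by
  have h : z ≤ y ⇨ (x ⇨ x * (y * z)) := by
    rw [← residuation, ← residuation]
  have curry : ∀ x y w : Lindenbaum Ax Γ, y ⇨ (x ⇨ w) ≤ x * y ⇨ w :=
    ind fun _ => ind fun _ => ind fun _ => .mul_imp _ _ _
  exact (residuation _ _ _).2 (h.trans (curry _ _ _))

theorem one_mul_eq : ∀ x : Lindenbaum Ax Γ, 1 * x = x :=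
  ind fun φ => le_antisymm (mul_imp_iff.2 (imp_exchange (.one_imp φ)))
    (show FLeDeduces Ax Γ (φ ⇨ (1 * φ)) from .modusPonens .one (imp_exchange (.imp_mul _ _)))

instance : CommMonoid (Lindenbaum Ax Γ) where
  mul_assoc x y z := le_antisymm (mul_assoc_le x y z) (by
    rw [Lindenbaum.mul_comm x (y * z), Lindenbaum.mul_comm y z, Lindenbaum.mul_comm (x * y) z,
      Lindenbaum.mul_comm x y]
    exact mul_assoc_le _ _ _)
  mul_comm := Lindenbaum.mul_comm
  one_mul := one_mul_eq
  mul_one x := (Lindenbaum.mul_comm x 1).trans (one_mul_eq x)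

/-- In the presence of weakening the Lindenbaum algebra is integral. -/
abbrev residuatedLattice (hw : ∀ φ ψ : F, FLeDeduces Ax Γ (φ ⇨ (ψ ⇨ φ))) :
    CommIntegralResiduatedLattice (Lindenbaum Ax Γ) where
  mul_le_iff_le_himp := residuation
  le_one := ind fun φ => show FLeDeduces Ax Γ (φ ⇨ 1) from .modusPonens .one (hw _ _)

theorem mk_eq_one_iff (hw : ∀ φ ψ : F, FLeDeduces Ax Γ (φ ⇨ (ψ ⇨ φ))) {φ : F} :
    mk Ax Γ φ = 1 ↔ FLeDeduces Ax Γ φ := by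
  refine ⟨fun h => ?_, fun h => le_antisymm ?_ ?_⟩
  · exact .modusPonens .one (mk_le_mk.1 h.ge)
  · exact mk_le_mk.2 (.modusPonens .one (hw _ _))
  · exact mk_le_mk.2 (.modusPonens h (hw _ _))

end Lindenbaum

/-- The Lindenbaum algebra of a set of premises in positive Łukasiewicz logic. -/
abbrev PosLindenbaum {n : ℕ} (Γ : Set (WTerm n)) : Type := Lindenbaum {ψ | PosLukAxiom ψ} Γ

namespace PosLindenbaum

variable {n : ℕ} {Γ : Set (WTerm n)}

theorem weakening (φ ψ : WTerm n) : PosLukDeduces Γ (φ ⇨ (ψ ⇨ φ)) :=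
  .ax (.weakening φ ψ)

instance : CommIntegralResiduatedLattice (PosLindenbaum Γ) :=
  Lindenbaum.residuatedLattice weakening

instance : WajsbergHoop (PosLindenbaum Γ) where
  tanaka := Lindenbaum.ind fun φ => Lindenbaum.ind fun ψ =>
    le_antisymm (Lindenbaum.mk_le_mk.2 (.ax (.tanaka φ ψ)))
      (Lindenbaum.mk_le_mk.2 (.ax (.tanaka ψ φ)))
  divisibility := Lindenbaum.ind fun φ => Lindenbaum.ind fun ψ =>
    le_antisymm (Lindenbaum.mk_le_mk.2 (.ax (.divisibility φ ψ)))
      (le_inf (mul_le_left' _ _) (mul_himp_le _ _))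

/-- The valuation of the variables by their own classes. -/
def val (Γ : Set (WTerm n)) (i : Fin n) : PosLindenbaum Γ := Lindenbaum.mk _ Γ (.var i)

theorem eval_val : ∀ t : WTerm n, t.eval (val Γ) = Lindenbaum.mk _ Γ t
  | .var _ => rfl
  | .one => rfl
  | .mul a b => by rw [WTerm.eval, eval_val a, eval_val b]; rfl
  | .imp a b => by rw [WTerm.eval, eval_val a, eval_val b]; rfl
  | .inf a b => by rw [WTerm.eval, eval_val a, eval_val b]; rfl
  | .sup a b => by rw [WTerm.eval, eval_val a, eval_val b]; rfl

theorem eval_val_eq_one_iff {t : WTerm n} : t.eval (val Γ) = 1 ↔ PosLukDeduces Γ t := by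
  rw [eval_val]
  exact Lindenbaum.mk_eq_one_iff weakening

/-- Local deduction theorem. -/
theorem exists_pow_le_of_insert {φ χ : WTerm n} (h : PosLukDeduces (insert φ Γ) χ) :
    ∃ k : ℕ, Lindenbaum.mk {ψ | PosLukAxiom ψ} Γ φ ^ k ≤ Lindenbaum.mk _ Γ χ := by
  have hone : ∀ ψ, PosLukDeduces Γ ψ → ∃ k : ℕ,
      Lindenbaum.mk {ψ | PosLukAxiom ψ} Γ φ ^ k ≤ Lindenbaum.mk _ Γ ψ := fun ψ hψ =>
    ⟨0, ((Lindenbaum.mk_eq_one_iff weakening).2 hψ).symm ▸ le_one (A := PosLindenbaum Γ) _⟩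
  refine FLeDeduces.induction_of_premises (P := fun χ => ∃ k : ℕ,
    Lindenbaum.mk {ψ | PosLukAxiom ψ} Γ φ ^ k ≤ Lindenbaum.mk _ Γ χ)
    (fun ψ h => ?_) (fun ψ h => ?_) (fun ψ χ h₁ h₂ => ?_) (fun ψ h => ?_) h
  · exact hone ψ (h.mono (Set.empty_subset _))
  · rcases h with rfl | h
    · exact ⟨1, (pow_one _).le⟩
    · exact hone ψ (.premise h)
  · obtain ⟨k, h₁⟩ := h₁
    obtain ⟨l, h₂⟩ := h₂
    refine ⟨k + l, ?_⟩
    rw [pow_add]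
    exact (mul_le_mul_of_le h₁ h₂).trans
      (mul_himp_le (A := PosLindenbaum Γ) (Lindenbaum.mk _ Γ ψ) (Lindenbaum.mk _ Γ χ))
  · obtain ⟨k, h⟩ := h
    exact ⟨k, le_inf h (le_one (A := PosLindenbaum Γ) _)⟩

end PosLindenbaum

/-- The Lindenbaum algebra of a set of premises in Łukasiewicz logic. -/
abbrev MVLindenbaum {n : ℕ} (Γ : Set (MVTerm n)) : Type := Lindenbaum {ψ | LukAxiom ψ} Γ

namespace MVLindenbaum

variable {n : ℕ} {Γ : Set (MVTerm n)}

theorem weakening (φ ψ : MVTerm n) : LukDeduces Γ (φ ⇨ (ψ ⇨ φ)) :=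
  .ax (.weakening φ ψ)

instance : CommIntegralResiduatedLattice (MVLindenbaum Γ) :=
  Lindenbaum.residuatedLattice weakening

instance : MVAlgebra (MVLindenbaum Γ) where
  zero := Lindenbaum.mk _ Γ 0
  zero_le := Lindenbaum.ind fun φ => Lindenbaum.mk_le_mk.2 (.ax (.exFalso φ))
  himp_himp_eq_sup := Lindenbaum.ind fun φ => Lindenbaum.ind fun ψ =>
    le_antisymm (Lindenbaum.mk_le_mk.2 (.ax (.lukasiewicz φ ψ)))
      (sup_le (le_himp_himp_self _ _) (le_himp_self _ _))

/-- The valuation of the variables by their own classes. -/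
def val (Γ : Set (MVTerm n)) (i : Fin n) : MVLindenbaum Γ := Lindenbaum.mk _ Γ (.var i)

theorem eval_val : ∀ t : MVTerm n, t.eval (val Γ) = Lindenbaum.mk _ Γ t
  | .var _ => rfl
  | .zero => rfl
  | .one => rfl
  | .mul a b => by rw [MVTerm.eval, eval_val a, eval_val b]; rfl
  | .imp a b => by rw [MVTerm.eval, eval_val a, eval_val b]; rfl
  | .inf a b => by rw [MVTerm.eval, eval_val a, eval_val b]; rfl
  | .sup a b => by rw [MVTerm.eval, eval_val a, eval_val b]; rfl

theorem eval_val_eq_one_iff {t : MVTerm n} : t.eval (val Γ) = 1 ↔ LukDeduces Γ t := by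
  rw [eval_val]
  exact Lindenbaum.mk_eq_one_iff weakening

end MVLindenbaum

/-! ### Completeness -/

/-- A set of premises that does not yield `u` and is maximal with this property has a totally
ordered Lindenbaum algebra. -/
theorem exists_total_posLindenbaum {n : ℕ} {Γ : Set (WTerm n)} {u : WTerm n}
    (h : ¬ PosLukDeduces Γ u) : ∃ Δ, Γ ⊆ Δ ∧ ¬ PosLukDeduces Δ u ∧
      Std.Total (fun x y : PosLindenbaum Δ => x ≤ y) := by
  obtain ⟨Δ, hΓ, hΔ⟩ := zorn_subset_nonempty {Δ | ¬ PosLukDeduces Δ u} (fun c hc hchain hne =>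
    ⟨⋃₀ c, fun hu => by
      obtain ⟨Δ, hΔ, h'⟩ := FLeDeduces.exists_of_sUnion hchain hne hu
      exact hc hΔ h', fun _ => Set.subset_sUnion_of_mem⟩) Γ h
  refine ⟨Δ, hΓ, hΔ.prop, ⟨Lindenbaum.ind fun φ => Lindenbaum.ind fun ψ => ?_⟩⟩
  rw [Lindenbaum.mk_le_mk, Lindenbaum.mk_le_mk]
  have key : ∀ χ : WTerm n, ¬ PosLukDeduces Δ χ → PosLukDeduces (insert χ Δ) u := fun χ hχ => by
    by_contra hu
    exact hχ (.premise (hΔ.le_of_ge hu (Set.subset_insert _ _) (Set.mem_insert _ _)))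
  by_contra! hn
  obtain ⟨k, hk⟩ := PosLindenbaum.exists_pow_le_of_insert (key _ hn.1)
  obtain ⟨l, hl⟩ := PosLindenbaum.exists_pow_le_of_insert (key _ hn.2)
  exact hΔ.prop ((Lindenbaum.mk_eq_one_iff PosLindenbaum.weakening).1
    (eq_one_of_pow_le (A := PosLindenbaum Δ) (a := Lindenbaum.mk _ Δ φ)
      (b := Lindenbaum.mk _ Δ ψ) hk hl))

theorem posLukDeduces_of_oneSet_subset {n : ℕ} {t u : WTerm n} (h : t.oneSet ⊆ u.oneSet) :
    PosLukDeduces {t} u := by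
  by_contra hu
  obtain ⟨Δ, htΔ, huΔ, htot⟩ := exists_total_posLindenbaum hu
  obtain ⟨p, hpt, hpu⟩ := exists_stdUnit_of_wajsbergChain (PosLindenbaum.val Δ) t u
    (PosLindenbaum.eval_val_eq_one_iff.2 (.premise (htΔ rfl)))
    (fun h' => huΔ (PosLindenbaum.eval_val_eq_one_iff.1 h'))
  exact hpu (h hpt)

/-! ### The standard algebra in an arbitrary universe -/

/-- A copy of the standard algebra in an arbitrary universe. -/
@[ext] structure LiftedUnit.{w} : Type w where
  /-- Lift an element of the standard algebra. -/
  up ::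
  /-- The underlying element of the standard algebra. -/
  down : StdUnit

namespace LiftedUnit

noncomputable section

instance : Lattice LiftedUnit.{w₁} where
  le x y := x.down ≤ y.down
  le_refl x := le_refl x.down
  le_trans _ _ _ h k := le_trans (α := StdUnit) h k
  le_antisymm _ _ h k := LiftedUnit.ext (le_antisymm h k)
  inf x y := ⟨x.down ⊓ y.down⟩
  inf_le_left x y := inf_le_left (a := x.down)
  inf_le_right x y := inf_le_right (a := x.down)
  le_inf x y z h k := le_inf (α := StdUnit) h k
  sup x y := ⟨x.down ⊔ y.down⟩
  le_sup_left x y := le_sup_left (a := x.down)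
  le_sup_right x y := le_sup_right (a := x.down)
  sup_le x y z h k := sup_le (α := StdUnit) h k

instance : MVAlgebra LiftedUnit.{w₁} where
  mul x y := ⟨x.down * y.down⟩
  one := ⟨1⟩
  mul_assoc x y z := LiftedUnit.ext (mul_assoc x.down y.down z.down)
  mul_comm x y := LiftedUnit.ext (mul_comm x.down y.down)
  one_mul x := LiftedUnit.ext (one_mul x.down)
  mul_one x := LiftedUnit.ext (mul_one x.down)
  himp x y := ⟨x.down ⇨ y.down⟩
  mul_le_iff_le_himp x y z := mul_le_iff_le_himp x.down y.down z.down
  le_one x := le_one x.down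
  zero := ⟨0⟩
  zero_le x := MVAlgebra.zero_le x.down
  himp_himp_eq_sup x y := LiftedUnit.ext (MVAlgebra.himp_himp_eq_sup x.down y.down)

end

theorem eval_up {n : ℕ} (p : Fin n → StdUnit) :
    ∀ t : WTerm n, t.eval (fun i => (⟨p i⟩ : LiftedUnit.{w₁})) = ⟨t.eval p⟩
  | .var _ => rfl
  | .one => rfl
  | .mul a b => by rw [WTerm.eval, eval_up p a, eval_up p b]; rfl
  | .imp a b => by rw [WTerm.eval, eval_up p a, eval_up p b]; rfl
  | .inf a b => by rw [WTerm.eval, eval_up p a, eval_up p b]; rfl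
  | .sup a b => by rw [WTerm.eval, eval_up p a, eval_up p b]; rfl

theorem eval_up_eq_one_iff {n : ℕ} (p : Fin n → StdUnit) (t : WTerm n) :
    t.eval (fun i => (⟨p i⟩ : LiftedUnit.{w₁})) = 1 ↔ t.eval p = 1 := by
  rw [eval_up]
  exact ⟨congrArg down, fun h => LiftedUnit.ext h⟩

end LiftedUnit

/-! ### The equivalence -/

theorem mainTheorem10 (n : ℕ) (t u : WTerm n) :
    List.TFAE [
      WHModels.{w₁} t u,
      t.oneSet ⊆ u.oneSet,
      MVModels.{w₂} t.toMV u.toMV,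
      PosLukDeduces {t} u,
      LukDeduces {t.toMV} u.toMV] := by
  tfae_have 1 → 2 := fun h p hp =>
    (LiftedUnit.eval_up_eq_one_iff p u).1 (h LiftedUnit _ ((LiftedUnit.eval_up_eq_one_iff p t).2 hp))
  tfae_have 3 → 2 := fun h p hp => by
    have h' := h LiftedUnit fun i => ⟨p i⟩
    rw [WTerm.eval_toMV, WTerm.eval_toMV, LiftedUnit.eval_up_eq_one_iff,
      LiftedUnit.eval_up_eq_one_iff] at h'
    exact h' hp
  tfae_have 5 → 2 := fun h p hp => by
    have h' := h.sound p fun φ hφ => by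
      rw [Set.mem_singleton_iff.1 hφ, WTerm.eval_toMV]
      exact hp
    rw [WTerm.eval_toMV] at h'
    exact h'
  tfae_have 2 → 4 := posLukDeduces_of_oneSet_subset
  tfae_have 4 → 1 := fun h A _ v ht => h.sound v (by simpa using ht)
  tfae_have 4 → 3 := fun h A _ v ht => by
    rw [WTerm.eval_toMV] at ht ⊢
    exact h.sound v (by simpa using ht)
  tfae_have 4 → 5 := fun h => by
    rw [← MVLindenbaum.eval_val_eq_one_iff, WTerm.eval_toMV]
    refine h.sound _ ?_
    rintro φ rfl
    rw [← WTerm.eval_toMV, MVLindenbaum.eval_val_eq_one_iff]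
    exact .premise rfl
  tfae_finish
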